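/- **Setting.** Let $N\in\mathbb N$. Let $C(S^{N-1}_{\mathbb R,+})$ be the universal unital $C^*$-algebra generated by self-adjoint elements $x_1,\ldots,x_N$ subject to $\sum_ix_i^2=1$. A (closed, noncommutative) subspace $S\subset S^{N-1}_{\mathbb R,+}$ is a closed two-sided ideal of this algebra, with quotient $C(S)$; inclusion $S\subset T$ means reverse inclusion of the ideals, and $S\cap T$ corresponds to the closed two-sided ideal generated by the two ideals. Imposing relations on the coordinates means passing to the closed two-sided ideal generated by them. *Main spheres.* $S^{N-1}_{\mathbb R}$ is the usual unit sphere of $\mathbb R^N$, embedded via the morphism $C(S^{N-1}_{\mathbb R,+})\to C(S^{N-1}_{\mathbb R})$ sending the $x_i$ to the coordinate functions. The half-liberated sphere $S^{N-1}_{\mathbb R,*}$ is obtained by imposing $x_ix_jx_k=x_kx_jx_i$ for all $i,j,k$. The twisted sphere $\bar S^{N-1}_{\mathbb R}$ is obtained by imposing $x_ix_j=-x_jx_i$ for $i\neq j$. The twisted half-liberated sphere $\bar S^{N-1}_{\mathbb R,*}$ is obtained by imposing $x_ix_jx_k=-x_kx_jx_i$ for $i,j,k$ distinct and $x_ix_jx_k=x_kx_jx_i$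 otherwise. For any of these spheres $\dot S^{N-1}_{\mathbb R,\times}$ (twisted or not), $\dot S^{N-1,d-1}_{\mathbb R,\times}\subset\dot S^{N-1}_{\mathbb R,\times}$ is obtained by imposing $x_{i_0}\cdots x_{i_d}=0$ for $i_0,\ldots,i_d$ distinct. *Relations.* For $\sigma\in S_k$, let $\mathcal R_\sigma$ be the relations $x_{i_1}\cdots x_{i_k}=x_{i_{\sigma(1)}}\cdots x_{i_{\sigma(k)}}$, for all $i_1,\ldots,i_k\in\{1,\ldots,N\}$, and let $\bar{\mathcal R}_\sigma$ be the relations $x_{i_1}\cdots x_{i_k}=\varepsilon(\pi_{i,\sigma})\,x_{i_{\sigma(1)}}\cdots x_{i_{\sigma(k)}}$, for all $i_1,\ldots,i_k$. Here $\pi_{i,\sigma}=\ker\binom{i_1\ \ldots\ i_k}{i_{\sigma(1)}\ldots i_{\sigma(k)}}$ is the partition of the $k$ upper and $k$ lower legs in which two legs are in the same block when they carry the same index, and $\varepsilon(\pi)=(-1)^c$, where $c$ is the number of switches of neighboring legs in the same row, belonging to different blocks, needed to make $\pi$ noncrossing (for partitions with all blocks of even size the parity of $c$ is well defined). For sets $E,F$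 of permutations of variable size $k\in\mathbb N$, the untwisted monomial sphere $S^{N-1}_{\mathbb R,E}$ is obtained from $S^{N-1}_{\mathbb R,+}$ by imposing $\mathcal R_\sigma$ for all $\sigma\in E$, the twisted monomial sphere $\bar S^{N-1}_{\mathbb R,F}$ by imposing $\bar{\mathcal R}_\sigma$ for all $\sigma\in F$, and the polygonal sphere is $S^{N-1}_{\mathbb R,E,F}=S^{N-1}_{\mathbb R,E}\cap\bar S^{N-1}_{\mathbb R,F}$. **Theorem 8.6.** For any $N\in\mathbb N$ the following hold: 1. $S^{N-1}_{\mathbb R}\subset S^{N-1}_{\mathbb R,*}\subset S^{N-1}_{\mathbb R,+}$, and the set of untwisted monomial spheres is $\{S^{N-1}_{\mathbb R},S^{N-1}_{\mathbb R,*},S^{N-1}_{\mathbb R,+}\}$. 2. $\bar S^{N-1}_{\mathbb R}\subset\bar S^{N-1}_{\mathbb R,*}\subset S^{N-1}_{\mathbb R,+}$, and the set of twisted monomial spheres is $\{\bar S^{N-1}_{\mathbb R},\bar S^{N-1}_{\mathbb R,*},S^{N-1}_{\mathbb R,+}\}$. 3. The set of polygonal spheres consists of the entries of the table $$\begin{matrix}S^{N-1}_{\mathbb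 R}&S^{N-1}_{\mathbb R,*}&S^{N-1}_{\mathbb R,+}\\ S^{N-1,1}_{\mathbb R}&S^{N-1,1}_{\mathbb R,*}&\bar S^{N-1}_{\mathbb R,*}\\ S^{N-1,0}_{\mathbb R}&\bar S^{N-1,1}_{\mathbb R}&\bar S^{N-1}_{\mathbb R}\end{matrix}$$ in which each entry is the intersection of the first entry in its column with the last entry in its row. For $N\geq3$ these nine spheres are pairwise distinct. -/

import Mathlib

open scoped ENNReal

namespace QSphere

noncomputable section

/-! ### The free sphere -/

/-- An `N`-tuple of self-adjoint elements, with squares summing up to `1`, in some nonzero unital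
C⋆-algebra, that is, a nonzero C⋆-algebra together with a solution of the relations
`xᵢ = xᵢ*`, `∑ xᵢ² = 1`. A C⋆-algebra generated by finitely many elements has at most continuum
many elements, so, up to isomorphism, no generated C⋆-algebra is lost by asking for `A : Type`. -/
structure SphereTuple (N : ℕ) : Type 1 where
  /-- the C⋆-algebra -/
  A : Type
  [cstar : CStarAlgebra A]
  [nontrivial : Nontrivial A]
  /-- the elements -/
  x : Fin N → A
  star_x : ∀ i, star (x i) = x i
  sum_sq : ∑ i, x i * x i = 1

attribute [instance] SphereTuple.cstar SphereTuple.nontrivial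

theorem SphereTuple.norm_le_one {N : ℕ} (t : SphereTuple N) (i : Fin N) : ‖t.x i‖ ≤ 1 := by
  let _ := CStarAlgebra.spectralOrder t.A
  have := CStarAlgebra.spectralOrderedRing t.A
  have hnn : ∀ j, 0 ≤ t.x j * t.x j := fun j => by
    have h := star_mul_self_nonneg (t.x j)
    rwa [t.star_x] at h
  have hle : t.x i * t.x i ≤ 1 := by
    rw [← t.sum_sq]
    exact Finset.single_le_sum (f := fun j => t.x j * t.x j) (fun j _ => hnn j)
      (Finset.mem_univ i)
  have h1 : ‖t.x i * t.x i‖ ≤ 1 := (CStarAlgebra.norm_le_one_iff_of_nonneg _ (hnn i)).2 hle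
  have h2 : ‖star (t.x i) * t.x i‖ = ‖t.x i‖ * ‖t.x i‖ := CStarRing.norm_star_mul_self
  rw [t.star_x] at h2
  nlinarith [norm_nonneg (t.x i)]

/-- The bounded families `(a_t)`, with `a_t` in the C⋆-algebra of `t`, for `t` ranging over all the
solutions of the relations defining the free sphere. -/
abbrev Ambient (N : ℕ) : Type 1 := lp (fun t : SphereTuple N => t.A) ∞

instance (N : ℕ) : CStarAlgebra (Ambient N) where

/-- The family of all `i`-th coordinates. -/
def ambientCoord (N : ℕ) (i : Fin N) : Ambient N :=
  ⟨fun t => t.x i, memℓp_infty ⟨1, by rintro _ ⟨t, rfl⟩; exact t.norm_le_one i⟩⟩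

/-- The closed `⋆`-subalgebra generated by the coordinates. -/
def freeSubalgebra (N : ℕ) : StarSubalgebra ℂ (Ambient N) :=
  (StarAlgebra.adjoin ℂ (Set.range (ambientCoord N))).topologicalClosure

/-- The algebra `C(S^{N-1}_{ℝ,+})`: the universal C⋆-algebra generated by self-adjoint elements
`x₁, …, x_N` with `∑ xᵢ² = 1`. The norm of a polynomial in the coordinates is the supremum of the
norms of its values in all C⋆-algebras; see `lift` and `hom_ext` for the universal property. -/
def FreeAlg (N : ℕ) : Type 1 := freeSubalgebra N

instance (N : ℕ) : IsClosed (freeSubalgebra N : Set (Ambient N)) :=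
  StarSubalgebra.isClosed_topologicalClosure _

instance (N : ℕ) : CStarAlgebra (FreeAlg N) :=
  inferInstanceAs (CStarAlgebra (freeSubalgebra N))

/-- The standard coordinates of the free sphere. -/
def coord {N : ℕ} (i : Fin N) : FreeAlg N :=
  ⟨ambientCoord N i, StarSubalgebra.le_topologicalClosure _
    (StarAlgebra.subset_adjoin ℂ _ ⟨i, rfl⟩)⟩

/-- Evaluation at a given solution of the relations. -/
def evalHom {N : ℕ} (t : SphereTuple N) : FreeAlg N →⋆ₐ[ℂ] t.A where
  toFun a := a.1.1 t
  map_one' := rfl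
  map_mul' _ _ := rfl
  map_zero' := rfl
  map_add' _ _ := rfl
  commutes' _ := rfl
  map_star' _ := rfl

theorem evalHom_coord {N : ℕ} (t : SphereTuple N) (i : Fin N) : evalHom t (coord i) = t.x i := rfl

/-- The evaluations separate the elements of `C(S^{N-1}_{ℝ,+})`. -/
theorem ext_evalHom {N : ℕ} {a b : FreeAlg N} (h : ∀ t, evalHom t a = evalHom t b) : a = b :=
  Subtype.ext (lp.ext (funext h))

theorem star_coord {N : ℕ} (i : Fin N) : star (coord i) = coord i := by
  refine ext_evalHom fun t => ?_
  rw [map_star, evalHom_coord, t.star_x]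

theorem sum_coord_sq (N : ℕ) : ∑ i : Fin N, coord i * coord i = 1 := by
  refine ext_evalHom fun t => ?_
  simp only [map_sum, map_mul, map_one, evalHom_coord, t.sum_sq]

/-- The existence part of the universal property of `C(S^{N-1}_{ℝ,+})`. -/
def lift {N : ℕ} {A : Type} [CStarAlgebra A] (x : Fin N → A) (hs : ∀ i, star (x i) = x i)
    (h1 : ∑ i, x i * x i = 1) : FreeAlg N →⋆ₐ[ℂ] A :=
  open Classical in
  if h : Nontrivial A then
    evalHom { A := A, x := x, star_x := hs, sum_sq := h1 }
  else
    haveI : Subsingleton A := not_nontrivial_iff_subsingleton.1 h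
    { toFun := fun _ => 0
      map_one' := Subsingleton.elim _ _
      map_mul' := fun _ _ => Subsingleton.elim _ _
      map_zero' := Subsingleton.elim _ _
      map_add' := fun _ _ => Subsingleton.elim _ _
      commutes' := fun _ => Subsingleton.elim _ _
      map_star' := fun _ => Subsingleton.elim _ _ }

theorem lift_coord {N : ℕ} {A : Type} [CStarAlgebra A] (x : Fin N → A)
    (hs : ∀ i, star (x i) = x i) (h1 : ∑ i, x i * x i = 1) (i : Fin N) :
    lift x hs h1 (coord i) = x i := by
  unfold lift
  split_ifs with h
  · rfl
  · have : Subsingleton A := not_nontrivial_iff_subsingleton.1 h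
    exact Subsingleton.elim _ _

theorem continuous_hom {N : ℕ} {A : Type*} [CStarAlgebra A] (f : FreeAlg N →⋆ₐ[ℂ] A) :
    Continuous f :=
  AddMonoidHomClass.continuous_of_bound f 1 fun a => by
    simpa only [one_mul] using NonUnitalStarAlgHom.norm_apply_le f a

/-- The uniqueness part of the universal property of `C(S^{N-1}_{ℝ,+})`. -/
theorem hom_ext {N : ℕ} {A : Type*} [CStarAlgebra A] {f g : FreeAlg N →⋆ₐ[ℂ] A}
    (h : ∀ i, f (coord i) = g (coord i)) : f = g := by
  refine StarAlgHom.ext_topologicalClosure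
    (S := StarAlgebra.adjoin ℂ (Set.range (ambientCoord N)))
    (continuous_hom f) (continuous_hom g) ?_
  refine StarAlgHom.ext_adjoin ?_
  rintro ⟨_, hx⟩ ⟨i, rfl⟩
  exact h i

/-! ### Closed subspaces of the free sphere -/

/-- A closed noncommutative subspace `S ⊂ S^{N-1}_{ℝ,+}`, given by a closed two-sided ideal: the
kernel of the quotient map `C(S^{N-1}_{ℝ,+}) → C(S)`. -/
@[ext]
structure Subspace (N : ℕ) : Type 1 where
  /-- the ideal of elements vanishing on `S` -/
  ideal : TwoSidedIdeal (FreeAlg N)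
  isClosed : IsClosed (ideal : Set (FreeAlg N))

/-- Inclusion of subspaces: `S ⊂ T` when `C(S)` is a quotient of `C(T)`. -/
instance (N : ℕ) : LE (Subspace N) := ⟨fun S T => T.ideal ≤ S.ideal⟩

/-- The subspace obtained by imposing the relations `r = 0`, for `r ∈ R`, that is, the one
corresponding to the closed two-sided ideal generated by `R`. -/
def ofRelations {N : ℕ} (R : Set (FreeAlg N)) : Subspace N where
  ideal := sInf {I | IsClosed (I : Set (FreeAlg N)) ∧ R ⊆ I}
  isClosed := by
    have h : ((sInf {I : TwoSidedIdeal (FreeAlg N) | IsClosed (I : Set (FreeAlg N)) ∧ R ⊆ I} :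
        TwoSidedIdeal (FreeAlg N)) : Set (FreeAlg N)) =
        ⋂ I ∈ {I : TwoSidedIdeal (FreeAlg N) | IsClosed (I : Set (FreeAlg N)) ∧ R ⊆ I},
          (I : Set (FreeAlg N)) := by
      ext x
      simp only [SetLike.mem_coe, TwoSidedIdeal.mem_sInf, Set.mem_iInter]
    rw [h]
    exact isClosed_biInter fun I hI => hI.1

/-- The intersection of two subspaces, obtained by merging their relations. -/
def inter {N : ℕ} (S T : Subspace N) : Subspace N :=
  ofRelations ((S.ideal : Set (FreeAlg N)) ∪ (T.ideal : Set (FreeAlg N)))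

/-- The subspace `X ⊂ S^{N-1}_{ℝ,+}` that is the image of a morphism of C⋆-algebras
`C(S^{N-1}_{ℝ,+}) → A`. -/
def ofHom {N : ℕ} {A : Type*} [CStarAlgebra A] (f : FreeAlg N →⋆ₐ[ℂ] A) : Subspace N where
  ideal := TwoSidedIdeal.ker f
  isClosed := by
    have h : ((TwoSidedIdeal.ker f : TwoSidedIdeal (FreeAlg N)) : Set (FreeAlg N)) =
        f ⁻¹' {0} := by
      ext x
      simp [TwoSidedIdeal.mem_ker]
    rw [h]
    exact isClosed_singleton.preimage (continuous_hom f)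

/-! ### The five main spheres -/

/-- The free sphere `S^{N-1}_{ℝ,+}`, as a subspace of itself. -/
def freeSphere (N : ℕ) : Subspace N := ofRelations ∅

/-- The unit sphere of the Euclidean space `ℝ^N`. -/
abbrev UnitSphere (N : ℕ) : Type := Metric.sphere (0 : EuclideanSpace ℝ (Fin N)) 1

/-- The coordinate functions on the unit sphere of `ℝ^N`. -/
def realCoord {N : ℕ} (i : Fin N) : C(UnitSphere N, ℂ) where
  toFun p := ((p : EuclideanSpace ℝ (Fin N)) i : ℂ)
  continuous_toFun := by fun_prop

/-- The quotient map `C(S^{N-1}_{ℝ,+}) → C(S^{N-1}_ℝ)`, sending the standard coordinates to the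
coordinate functions. -/
def toReal (N : ℕ) : FreeAlg N →⋆ₐ[ℂ] C(UnitSphere N, ℂ) :=
  lift realCoord (fun i => by ext p; simp [realCoord]) (by
    ext p
    have hp : ‖(p : EuclideanSpace ℝ (Fin N))‖ = 1 := by simp
    have h : ∑ i, (p : EuclideanSpace ℝ (Fin N)) i * (p : EuclideanSpace ℝ (Fin N)) i = 1 := by
      have h2 := EuclideanSpace.real_norm_sq_eq (p : EuclideanSpace ℝ (Fin N))
      rw [hp] at h2
      simp only [← sq]
      linarith
    simp only [ContinuousMap.coe_sum, Finset.sum_apply, ContinuousMap.mul_apply,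
      ContinuousMap.one_apply, realCoord, ContinuousMap.coe_mk]
    exact_mod_cast h)

/-- The usual sphere `S^{N-1}_ℝ`, as a subspace of the free sphere. -/
def realSphere (N : ℕ) : Subspace N := ofHom (toReal N)

/-- The half-liberated sphere `S^{N-1}_{ℝ,*}`. -/
def halfSphere (N : ℕ) : Subspace N :=
  ofRelations {r | ∃ i j k : Fin N, r = coord i * coord j * coord k - coord k * coord j * coord i}

/-- The twisted sphere: `xᵢxⱼ = -xⱼxᵢ` for `i ≠ j`. -/
def twistedSphere (N : ℕ) : Subspace N :=
  ofRelations {r | ∃ i j : Fin N, i ≠ j ∧ r = coord i * coord j + coord j * coord i}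

/-- The twisted half-liberated sphere: `xᵢxⱼx_k = -x_kxⱼxᵢ` for `i, j, k` distinct, and
`xᵢxⱼx_k = x_kxⱼxᵢ` otherwise. -/
def twistedHalfSphere (N : ℕ) : Subspace N :=
  ofRelations
    ({r | ∃ i j k : Fin N, (i ≠ j ∧ j ≠ k ∧ i ≠ k) ∧
        r = coord i * coord j * coord k + coord k * coord j * coord i} ∪
     {r | ∃ i j k : Fin N, ¬ (i ≠ j ∧ j ≠ k ∧ i ≠ k) ∧
        r = coord i * coord j * coord k - coord k * coord j * coord i})

/-! ### The signature of a partition -/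

section Signature

variable {k l : ℕ}

/-- The position of a leg of a partition in `P(k,l)`, having `k` upper and `l` lower legs, counted
clockwise from top left. -/
def clockwise : Fin k ⊕ Fin l → ℕ
  | Sum.inl p => p
  | Sum.inr q => k + q.rev

/-- A partition in `P(k,l)` is noncrossing when no two distinct blocks cross. -/
def IsNoncrossing (π : Setoid (Fin k ⊕ Fin l)) : Prop :=
  ∀ a b c d : Fin k ⊕ Fin l, clockwise a < clockwise b → clockwise b < clockwise c →
    clockwise c < clockwise d → π.r a c → π.r b d → π.r a b

/-- `SwitchesTo c π ρ`: the partition `ρ` is obtained from `π` by performing `c` switches of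
neighboring legs, both in the upper row or both in the lower row, that belong to different
blocks. -/
inductive SwitchesTo : ℕ → Setoid (Fin k ⊕ Fin l) → Setoid (Fin k ⊕ Fin l) → Prop
  | refl (π : Setoid (Fin k ⊕ Fin l)) : SwitchesTo 0 π π
  | upper {c : ℕ} {π ρ : Setoid (Fin k ⊕ Fin l)} (p q : Fin k) (hpq : (p : ℕ) + 1 = q)
      (hblock : ¬ π.r (Sum.inl p) (Sum.inl q))
      (h : SwitchesTo c (π.comap (Equiv.swap (Sum.inl p) (Sum.inl q))) ρ) :
      SwitchesTo (c + 1) π ρ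
  | lower {c : ℕ} {π ρ : Setoid (Fin k ⊕ Fin l)} (p q : Fin l) (hpq : (p : ℕ) + 1 = q)
      (hblock : ¬ π.r (Sum.inr p) (Sum.inr q))
      (h : SwitchesTo c (π.comap (Equiv.swap (Sum.inr p) (Sum.inr q))) ρ) :
      SwitchesTo (c + 1) π ρ

open Classical in
/-- The signature `ε(π) = (-1)^c`, where `c` is the number of switches needed to make `π`
noncrossing. For a partition all of whose blocks have even size, the parity of `c` does not depend
on the choice of the switches. -/
def signature (π : Setoid (Fin k ⊕ Fin l)) : ℤ :=
  if ∃ c ρ, Even c ∧ SwitchesTo c π ρ ∧ IsNoncrossing ρ then 1 else -1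

/-- The kernel of a multi-index with upper row `i` and lower row `j`: two legs are in the same block
when they carry the same index. -/
def kernel {N : ℕ} (i : Fin k → Fin N) (j : Fin l → Fin N) : Setoid (Fin k ⊕ Fin l) :=
  Setoid.ker (Sum.elim i j)

end Signature

/-! ### Untwisted, twisted and polygonal spheres -/

/-- The monomial `x_{i₁} ⋯ x_{i_k}`. -/
def monomial {N k : ℕ} (i : Fin k → Fin N) : FreeAlg N := (List.ofFn fun p => coord (i p)).prod

/-- The untwisted relations associated to `σ ∈ S_k`, for all the multi-indices `i`. -/
def untwistedRel (N : ℕ) {k : ℕ} (σ : Equiv.Perm (Fin k)) : Set (FreeAlg N) :=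
  {r | ∃ i : Fin k → Fin N, r = monomial i - monomial (i ∘ σ)}

/-- The twisted relations associated to `σ ∈ S_k`, for all the multi-indices `i`. -/
def twistedRel (N : ℕ) {k : ℕ} (σ : Equiv.Perm (Fin k)) : Set (FreeAlg N) :=
  {r | ∃ i : Fin k → Fin N, r = monomial i - signature (kernel i (i ∘ σ)) • monomial (i ∘ σ)}

/-- Permutations of variable size. -/
abbrev Permutation : Type := Σ k : ℕ, Equiv.Perm (Fin k)

/-- The untwisted monomial sphere associated to a set of permutations. -/
def untwistedMonomial (N : ℕ) (E : Set Permutation) : Subspace N :=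
  ofRelations (⋃ σ ∈ E, untwistedRel N σ.2)

/-- The twisted monomial sphere associated to a set of permutations. -/
def twistedMonomial (N : ℕ) (F : Set Permutation) : Subspace N :=
  ofRelations (⋃ σ ∈ F, twistedRel N σ.2)

/-- The polygonal sphere associated to two sets of permutations. -/
def polygonal (N : ℕ) (E F : Set Permutation) : Subspace N :=
  inter (untwistedMonomial N E) (twistedMonomial N F)

/-! ### The nine main spheres -/

/-- The subspace of `S` obtained by assuming that `x_{i₀} ⋯ x_{i_d} = 0`, for `i₀, …, i_d`
distinct. -/
def vanishing {N : ℕ} (d : ℕ) (S : Subspace N) : Subspace N :=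
  inter S (ofRelations {r | ∃ i : Fin (d + 1) → Fin N, Function.Injective i ∧ r = monomial i})

/-- The untwisted spheres, from the smallest to the largest. -/
def untwistedMain (N : ℕ) : Fin 3 → Subspace N := ![realSphere N, halfSphere N, freeSphere N]

/-- The twisted spheres, from the smallest to the largest. -/
def twistedMain (N : ℕ) : Fin 3 → Subspace N :=
  ![twistedSphere N, twistedHalfSphere N, freeSphere N]

/-- The nine main spheres: `nineMain N b a` is the entry in the row of the `b`-th twisted sphere and
the column of the `a`-th untwisted sphere. -/
def nineMain (N : ℕ) : Fin 3 → Fin 3 → Subspace N :=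
  ![![vanishing 1 (realSphere N), vanishing 2 (twistedSphere N), twistedSphere N],
    ![vanishing 2 (realSphere N), vanishing 2 (halfSphere N), twistedHalfSphere N],
    ![realSphere N, halfSphere N, freeSphere N]]

end

end QSphere

/-! Everything except the identification of the classical sphere is pure algebra, in a ring with a
family satisfying `∑ xᵢ² = 1`. That identity allows cancellation: common outer letters of an
equation between words can be erased when they are arbitrary (`eq_of_word_mul_eq`,
`eq_of_mul_word_eq`), and inner pairs `xᵢxᵢ` can be summed away (`eq_of_capped`).

Untwisted case. The permutations whose relations hold are closed under products, inverses and
translations. A nontrivial permutation and a translate of it whose supports meet at a single point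
have a 3-cycle as commutator, and after cancellation a 3-cycle gives at least half-commutation
(`Rel.halfCommute`). Conversely, half-commutation gives exactly the parity-preserving rearrangements
for free (`HalfCommute.rel`). A permutation breaking parity conjugates a transposition across an odd
gap into one across an even gap, which capping turns into commutation (`Rel.pairwiseCommute`). Hence
there are only three cases: trivial relations, half-commutation, commutation.

Twisted case. Replace `xᵢ` by `xᵢ ⊗ eᵢ`, where the `eᵢ` are anticommuting symmetries in a Clifford
algebra. The squares still sum to `1`, and the signature of a kernel is the sign obtained by
reordering the `eᵢ` (`intCast_signature_kernel`). So the twisted relations for `x` are the untwisted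
ones for the twist (`finRel_twist_iff`), and the same three cases result.

A subspace is determined by the closed ideals containing its own ideal, so spheres are compared
through the relations holding in the quotient rings. Only the classical sphere, defined by a
morphism rather than by relations, needs analysis: Gelfand duality for the quotient by the
commutators shows that commutation defines it (`realSphere_eq`).

In the table, a relation and its signed version together say `2w = 0`, which produces the vanishing
monomials (`nineMain_eq_inter`). Scaled Pauli matrices satisfy all twisted relations and separate
the untwisted spheres; points of the classical sphere do the converse. Together they separate the
nine intersections when `N ≥ 3`. -/

namespace QSphere

open Equiv
open scoped TensorProduct

/-! ### Words, permutation relations and cancellation. -/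

section Words

variable {ι A : Type*} [Ring A] (x : ι → A)

/-- The product of the entries of `x` along a word. -/
def word (w : List ι) : A := (w.map x).prod

@[simp] theorem word_nil : word x [] = 1 := rfl

@[simp] theorem word_cons (i : ι) (w : List ι) : word x (i :: w) = x i * word x w := by
  simp [word]

@[simp] theorem word_append (v w : List ι) : word x (v ++ w) = word x v * word x w := by
  simp [word]

/-- The relations associated to a permutation, for words of length `n`. -/
def Rel (n : ℕ) (σ : Perm ℕ) : Prop :=
  ∀ i : ℕ → ι, word x ((List.range n).map i) = word x ((List.range n).map (i ∘ σ))

variable {x}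

theorem Rel.mul {n : ℕ} {σ τ : Perm ℕ} (hσ : Rel x n σ) (hτ : Rel x n τ) : Rel x n (σ * τ) :=
  fun i => (hσ i).trans (hτ (i ∘ σ))

theorem Rel.inv {n : ℕ} {σ : Perm ℕ} (hσ : Rel x n σ) : Rel x n σ⁻¹ := fun i => by
  have h := hσ (i ∘ ⇑σ⁻¹)
  have h2 : (i ∘ ⇑σ⁻¹) ∘ ⇑σ = i := by ext p; simp
  rw [h2] at h
  exact h.symm

theorem Rel.mono {n : ℕ} {σ : Perm ℕ} (hσ : Rel x n σ) (hfix : ∀ p, n ≤ p → σ p = p) {m : ℕ}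
    (hm : n ≤ m) : Rel x m σ := by
  obtain ⟨k, rfl⟩ := Nat.exists_eq_add_of_le hm
  intro i
  have h : ((List.range k).map (n + ·)).map (i ∘ σ) = ((List.range k).map (n + ·)).map i := by
    simp [hfix]
  rw [List.range_add, List.map_append, List.map_append, word_append, word_append, h, hσ i]

/-- The permutation `σ`, acting on the integers `≥ m`. -/
def shiftPerm (m : ℕ) (σ : Perm ℕ) : Perm ℕ :=
  σ.extendDomain (p := fun p => m ≤ p)
    { toFun := fun p => ⟨m + p, Nat.le_add_right m p⟩
      invFun := fun p => p.1 - m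
      left_inv := fun p => by simp
      right_inv := fun p => Subtype.ext (by have := p.2; simp only; omega) }

theorem shiftPerm_add (m : ℕ) (σ : Perm ℕ) (p : ℕ) : shiftPerm m σ (m + p) = m + σ p :=
  Perm.extendDomain_apply_image σ (p := fun p => m ≤ p) _ p

theorem shiftPerm_of_lt {m p : ℕ} (σ : Perm ℕ) (hp : p < m) : shiftPerm m σ p = p :=
  Perm.extendDomain_apply_not_subtype _ _ (by omega)

theorem Rel.shift {n : ℕ} {σ : Perm ℕ} (hσ : Rel x n σ) (m : ℕ) :
    Rel x (m + n) (shiftPerm m σ) := by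
  intro i
  have h1 : (List.range m).map (i ∘ shiftPerm m σ) = (List.range m).map i :=
    List.map_congr_left fun p hp => by
      rw [Function.comp_apply, shiftPerm_of_lt _ (List.mem_range.1 hp)]
  have h2 : ((List.range n).map (m + ·)).map (i ∘ shiftPerm m σ) =
      (List.range n).map ((fun p => i (m + p)) ∘ σ) := by
    simp [shiftPerm_add]
  have h3 := hσ fun p => i (m + p)
  rw [List.range_add, List.map_append, List.map_append, word_append, word_append, h1, h2, ← h3]
  simp [Function.comp_def]

theorem Rel.word_eq {n : ℕ} {σ : Perm ℕ} (hσ : Rel x n σ) {L L' : List ι} (hL : L.length = n)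
    (hL' : L'.length = n) (h : ∀ m < n, L'[m]? = L[σ m]?) : word x L = word x L' := by
  rcases L with _ | ⟨d, T⟩
  · simp at hL; subst hL; simp at hL'; subst hL'; rfl
  · set L := d :: T
    have h1 : (List.range n).map (fun m => L[m]?.getD d) = L := by
      apply List.ext_getElem <;> grind
    have h2 : (List.range n).map ((fun m => L[m]?.getD d) ∘ σ) = L' := by
      apply List.ext_getElem <;> grind
    rw [← h1, ← h2]
    exact hσ _

variable [Fintype ι]

/-- Multiplying `xᵢa = xᵢb` by `xᵢ` on the left and summing over `i` removes one letter of the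
prefix. -/
theorem eq_of_word_mul_eq (hx : ∑ i, x i * x i = 1) {a b : A} (n : ℕ)
    (h : ∀ P : List ι, P.length = n → word x P * a = word x P * b) : a = b := by
  induction n generalizing a b with
  | zero => simpa using h [] rfl
  | succ n ih =>
    have h2 : ∀ i, x i * a = x i * b := fun i => ih fun P hP => by
      simpa [mul_assoc] using h (P ++ [i]) (by simp [hP])
    calc a = ∑ i, x i * (x i * a) := by simp_rw [← mul_assoc, ← Finset.sum_mul, hx, one_mul]
      _ = ∑ i, x i * (x i * b) := by simp_rw [h2]
      _ = b := by simp_rw [← mul_assoc, ← Finset.sum_mul, hx, one_mul]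

theorem eq_of_mul_word_eq (hx : ∑ i, x i * x i = 1) {a b : A} (n : ℕ)
    (h : ∀ P : List ι, P.length = n → a * word x P = b * word x P) : a = b := by
  induction n generalizing a b with
  | zero => simpa using h [] rfl
  | succ n ih =>
    have h2 : ∀ i, a * x i = b * x i := fun i => ih fun P hP => by
      simpa [mul_assoc] using h (i :: P) (by simp [hP])
    calc a = ∑ i, a * x i * x i := by simp_rw [mul_assoc, ← Finset.mul_sum, hx, mul_one]
      _ = ∑ i, b * x i * x i := by simp_rw [h2]
      _ = b := by simp_rw [mul_assoc, ← Finset.mul_sum, hx, mul_one]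

/-- Two equal neighboring letters can be capped. -/
theorem eq_of_capped (hx : ∑ i, x i * x i = 1) (f g : A →+ A) {n : ℕ} (m : ℕ)
    (h : ∀ U : List ι, U.length = n + 2 * m → f (word x U) = g (word x U)) (U : List ι)
    (hU : U.length = n) : f (word x U) = g (word x U) := by
  induction m generalizing U n with
  | zero => exact h U (by simpa using hU)
  | succ m ih =>
    have h2 : ∀ i, f (word x (U ++ [i, i])) = g (word x (U ++ [i, i])) := fun i =>
      ih (n := n + 2) (fun V hV => h V (by omega)) _ (by simp [hU])
    have h3 : word x U = ∑ i, word x (U ++ [i, i]) := by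
      simp [← Finset.mul_sum, hx]
    rw [h3, map_sum, map_sum]
    exact Finset.sum_congr rfl fun i _ => h2 i

/-- Half-commutation. -/
def HalfCommute (x : ι → A) : Prop := ∀ i j k, x i * x j * x k = x k * x j * x i

/-- Commutation. -/
def PairwiseCommute (x : ι → A) : Prop := ∀ i j, x i * x j = x j * x i

/-- The letters outside the interval from `a` to `b` are not moved, so they form an arbitrary prefix
and suffix, which cancel. -/
theorem Rel.swap_word (hx : ∑ i, x i * x i = 1) {n a b : ℕ} (hab : a < b) (hb : b < n)
    (h : Rel x n (swap a b)) (U : List ι) (hU : U.length = b - a - 1) (p q : ι) :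
    x p * word x U * x q = x q * word x U * x p := by
  refine eq_of_word_mul_eq hx a fun P hP => eq_of_mul_word_eq hx (n - b - 1) fun Q hQ => ?_
  have := h.word_eq (L := P ++ p :: U ++ q :: Q) (L' := P ++ q :: U ++ p :: Q)
    (by simp; omega) (by simp; omega) (fun m hm => by
      rw [swap_apply_def]
      split_ifs <;> grind)
  simpa [mul_assoc] using this

theorem Rel.cycle_word (hx : ∑ i, x i * x i = 1) {n a b c : ℕ} (hab : a < b) (hbc : b < c)
    (hc : c < n) {ρ : Perm ℕ} (h : Rel x n ρ) (ha : ρ a = c) (hb : ρ b = a) (hc2 : ρ c = b)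
    (hρ : ∀ p, p ≠ a → p ≠ b → p ≠ c → ρ p = p) (U V : List ι) (hU : U.length = b - a - 1)
    (hV : V.length = c - b - 1) (p q r : ι) :
    x p * word x U * x q * word x V * x r = x r * word x U * x p * word x V * x q := by
  refine eq_of_word_mul_eq hx a fun P hP => eq_of_mul_word_eq hx (n - c - 1) fun Q hQ => ?_
  have := h.word_eq (L := P ++ p :: U ++ q :: V ++ r :: Q) (L' := P ++ r :: U ++ p :: V ++ q :: Q)
    (by simp; omega) (by simp; omega) (fun m hm => by
      by_cases h1 : m = a
      · subst h1; rw [ha]; grind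
      by_cases h2 : m = b
      · subst h2; rw [hb]; grind
      by_cases h3 : m = c
      · subst h3; rw [hc2]; grind
      rw [hρ m h1 h2 h3]
      grind)
  simpa [mul_assoc] using this

end Words

theorem perm_apply_inv {α : Type*} (σ : Perm α) (a : α) : σ (σ⁻¹ a) = a := by simp

theorem perm_inv_apply {α : Type*} (σ : Perm α) (a : α) : σ⁻¹ (σ a) = a := by simp

/-! ### Classification of the relations: half-commutation or commutation. -/

section Classification

variable {ι A : Type*} [Ring A] {x : ι → A}

theorem PairwiseCommute.halfCommute (h : PairwiseCommute x) : HalfCommute x := fun i j k => by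
  rw [h i j, mul_assoc, h i k, ← mul_assoc, h j k]

/-- With `U = stU'`, use the shorter exchange across `U'` to bring `q` next to `ps`, half-commute
`psq` into `qsp`, and exchange back across `U'`. -/
theorem HalfCommute.swap_word (h : HalfCommute x) (U : List ι) (hU : Odd U.length) (p q : ι) :
    x p * word x U * x q = x q * word x U * x p := by
  induction U using List.twoStepInduction generalizing p q with
  | nil => simp at hU
  | singleton s => simpa using h p s q
  | cons_cons s t U ih _ =>
    have hU' : Odd U.length := by
      simp only [List.length_cons] at hU
      rw [Nat.odd_iff] at hU ⊢
      omega
    calc x p * word x (s :: t :: U) * x q = x p * x s * (x t * word x U * x q) := by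
          simp [mul_assoc]
      _ = (x p * x s * x q) * word x U * x t := by rw [ih hU']; simp only [mul_assoc]
      _ = x q * x s * (x p * word x U * x t) := by rw [h p s q]; simp only [mul_assoc]
      _ = x q * word x (s :: t :: U) * x p := by rw [ih hU']; simp [mul_assoc]

theorem rel_swap {a b n : ℕ} (hab : a < b) (hb : b < n)
    (h : ∀ (U : List ι) (p q : ι), U.length = b - a - 1 →
      x p * word x U * x q = x q * word x U * x p) : Rel x n (swap a b) := by
  obtain ⟨u, rfl⟩ : ∃ u, b = a + 1 + u := ⟨b - a - 1, by omega⟩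
  obtain ⟨v, rfl⟩ : ∃ v, n = a + 1 + u + 1 + v := ⟨n - (a + 1 + u) - 1, by omega⟩
  intro i
  have hP : (List.range a).map (i ∘ swap a (a + 1 + u)) = (List.range a).map i :=
    List.map_congr_left fun p hp => by
      have := List.mem_range.1 hp
      rw [Function.comp_apply, swap_apply_of_ne_of_ne] <;> omega
  have hU : (List.range u).map ((i ∘ swap a (a + 1 + u)) ∘ (a + 1 + ·)) =
      (List.range u).map (i ∘ (a + 1 + ·)) :=
    List.map_congr_left fun p hp => by
      have := List.mem_range.1 hp
      simp only [Function.comp_apply]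
      rw [swap_apply_of_ne_of_ne] <;> omega
  have hV : (List.range v).map ((i ∘ swap a (a + 1 + u)) ∘ (a + 1 + u + 1 + ·)) =
      (List.range v).map (i ∘ (a + 1 + u + 1 + ·)) :=
    List.map_congr_left fun p hp => by
      simp only [Function.comp_apply]
      rw [swap_apply_of_ne_of_ne] <;> omega
  have h2 := h ((List.range u).map (i ∘ (a + 1 + ·))) (i a) (i (a + 1 + u)) (by simp; omega)
  simp only [List.range_add, List.map_append, word_append, List.map_map, hP, hU, hV,
    List.range_one, List.map_cons, List.map_nil, word_cons, word_nil, mul_one,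
    Function.comp_apply, add_zero, swap_apply_left, swap_apply_right]
  congr 1
  simp only [mul_assoc] at h2 ⊢
  rw [h2]

/-- Half-commutation implies the relations of all the parity preserving permutations. -/
theorem HalfCommute.rel (h : HalfCommute x) (n : ℕ) (σ : Perm ℕ) (hfix : ∀ p, n ≤ p → σ p = p)
    (hσ : ∀ p, σ p % 2 = p % 2) : Rel x n σ := by
  induction n generalizing σ with
  | zero =>
    intro i
    simp
  | succ n ih =>
    have hle : ∀ q, σ q = n → q ≤ n := fun q hq => by
      by_contra hc
      have := hfix q (by omega)
      omega
    have hlt : σ n ≤ n := by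
      by_contra hc
      have h1 := hfix (σ n) (by omega)
      have := σ.injective h1
      omega
    rcases eq_or_lt_of_le hlt with heq | hlt
    · refine (ih σ (fun p hp => ?_) hσ).mono (fun p hp => ?_) (Nat.le_succ n) <;>
      · rcases eq_or_lt_of_le hp with rfl | hp
        · exact heq
        · exact hfix p hp
    -- Composing with the transposition of `σ n` and `n` makes `n` a fixed point. Both positions
    -- have the same parity, so the gap between them is odd and half-commutation applies.
    · have hsw : Rel x (n + 1) (swap (σ n) n) := rel_swap hlt (Nat.lt_succ_self n) fun U p q hU =>
        h.swap_word U (by rw [hU, Nat.odd_iff]; have := hσ n; omega) p q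
      have hfix' : ∀ p, n ≤ p → (swap (σ n) n * σ) p = p := fun p hp => by
        rcases eq_or_lt_of_le hp with rfl | hp
        · simp
        · rw [Perm.mul_apply, hfix p hp, swap_apply_of_ne_of_ne] <;> omega
      have hrel := ih (swap (σ n) n * σ) hfix' (fun p => by
        rw [Perm.mul_apply, swap_apply_def]
        have := hσ n
        have := hσ p
        split_ifs <;> omega)
      have := hsw.mul (hrel.mono hfix' (Nat.le_succ n))
      rwa [← mul_assoc, swap_mul_self, one_mul] at this

variable [Fintype ι]

/-- Capping reduces the gaps `u`, `v` of the 3-cycle to their parities. In each of the four cases a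
further sum over a repeated letter leaves commutation, or half-commutation when both gaps are odd.
-/
theorem halfCommute_of_cycle_word (hx : ∑ i, x i * x i = 1) (u v : ℕ)
    (h : ∀ (U V : List ι), U.length = u → V.length = v → ∀ p q r : ι,
      x p * word x U * x q * word x V * x r = x r * word x U * x p * word x V * x q) :
    HalfCommute x := by
  have hmod : ∀ (U V : List ι), U.length = u % 2 → V.length = v % 2 → ∀ p q r : ι,
      x p * word x U * x q * word x V * x r = x r * word x U * x p * word x V * x q := by
    intro U V hU hV p q r
    let f (p q r : ι) (U : List ι) : A →+ A :=
      AddMonoidHom.mk' (fun w => x p * word x U * x q * w * x r) (by intros; noncomm_ring)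
    let g (p q r : ι) (V : List ι) : A →+ A :=
      AddMonoidHom.mk' (fun w => x p * w * x q * word x V * x r) (by intros; noncomm_ring)
    refine eq_of_capped hx (f p q r U) (f r p q U) (v / 2) (fun V' hV' => ?_) V hV
    refine eq_of_capped hx (g p q r V') (g r p q V') (u / 2) (fun U' hU' => ?_) U hU
    exact h U' V' (by omega) (by omega) p q r
  have hl : ∀ a : A, ∑ i, x i * (x i * a) = a := fun a => by
    simp_rw [← mul_assoc, ← Finset.sum_mul, hx, one_mul]
  rcases Nat.mod_two_eq_zero_or_one u with hu | hu <;>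
    rcases Nat.mod_two_eq_zero_or_one v with hv | hv <;> rw [hu, hv] at hmod
  -- No gaps: three letters can be rotated. Insert `∑ x_q x_q` in the middle of `x_p x_s` and rotate
  -- until the pair stands at the end.
  · have h3 : ∀ p q r, x p * (x q * x r) = x r * (x p * x q) := fun p q r => by
      simpa [mul_assoc] using hmod [] [] rfl rfl p q r
    refine PairwiseCommute.halfCommute fun p s => ?_
    calc x p * x s = ∑ q, x p * (x q * (x q * x s)) := by rw [← Finset.mul_sum, hl]
      _ = ∑ q, x s * (x p * (x q * x q)) := Finset.sum_congr rfl fun q _ => by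
          rw [← mul_assoc (x q), ← mul_assoc, h3, mul_assoc, mul_assoc, h3 p q s, ← mul_assoc (x s),
            ← mul_assoc, ← h3 s p q, mul_assoc, mul_assoc, h3 p q q]
      _ = x s * x p := by rw [← Finset.mul_sum, ← Finset.mul_sum, hx, mul_one]
  -- Choosing the gap letter equal to the middle letter `q` creates a square on each side, to be
  -- summed over `q`.
  · refine PairwiseCommute.halfCommute fun p r => ?_
    have h3 : ∀ q, x p * (x q * (x q * x r)) = x r * (x p * (x q * x q)) := fun q => by
      simpa [mul_assoc] using hmod [] [q] rfl rfl p q r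
    have := Finset.sum_congr rfl fun q (_ : q ∈ Finset.univ) => h3 q
    rwa [← Finset.mul_sum, hl, ← Finset.mul_sum, ← Finset.mul_sum, hx, mul_one] at this
  · refine PairwiseCommute.halfCommute fun q r => ?_
    have h3 : ∀ p, x p * (x p * (x q * x r)) = x r * (x p * (x p * x q)) := fun p => by
      simpa [mul_assoc] using hmod [p] [] rfl rfl p q r
    have := Finset.sum_congr rfl fun q (_ : q ∈ Finset.univ) => h3 q
    rwa [hl, ← Finset.mul_sum, hl] at this
  · intro p s r
    have h3 : ∀ q, x p * (x s * (x q * (x q * x r))) = x r * (x s * (x p * (x q * x q))) :=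
      fun q => by simpa [mul_assoc] using hmod [s] [q] rfl rfl p q r
    have := Finset.sum_congr rfl fun q (_ : q ∈ Finset.univ) => h3 q
    simp only [← Finset.mul_sum, hl, hx, mul_one] at this
    simpa [mul_assoc] using this

/-- The commutator of two permutations whose supports meet at one point is a `3`-cycle. -/
theorem Rel.halfCommute_of_overlap (hx : ∑ i, x i * x i = 1) {n c : ℕ} {σ τ : Perm ℕ}
    (hσ : Rel x n σ) (hτ : Rel x n τ) (hσc : ∀ p, c < p → σ p = p) (hτc : ∀ p, p < c → τ p = p)
    (hσ' : σ c ≠ c) (hτ' : τ c ≠ c) (hn : τ c < n) : HalfCommute x := by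
  have hσle : ∀ p, p ≤ c → σ⁻¹ p ≤ c := fun p hp => by
    by_contra hc
    have h1 := hσc _ (not_le.1 hc)
    rw [perm_apply_inv] at h1
    omega
  have hτge : ∀ p, c ≤ p → c ≤ τ⁻¹ p := fun p hp => by
    by_contra hc
    have h1 := hτc _ (not_le.1 hc)
    rw [perm_apply_inv] at h1
    omega
  have hd : σ c < c := by
    by_contra hc
    have h1 := hσc (σ c) (by omega)
    exact hσ' (σ.injective h1)
  have hf : c < τ c := by
    by_contra hc
    have h1 := hτc (τ c) (by omega)
    exact hτ' (τ.injective h1)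
  have hσi : ∀ p, c < p → σ⁻¹ p = p := fun p hp => by rw [Perm.inv_eq_iff_eq, hσc p hp]
  have hτi : ∀ p, p < c → τ⁻¹ p = p := fun p hp => by rw [Perm.inv_eq_iff_eq, hτc p hp]
  -- The commutator sends `σ c ↦ τ c`, `c ↦ σ c`, `τ c ↦ c` and fixes the rest; here `σ c < c < τ
  -- c`.
  have hρ := (hσ.mul hτ).mul (hσ.inv.mul hτ.inv)
  have happ : ∀ p, (σ * τ * (σ⁻¹ * τ⁻¹)) p = σ (τ (σ⁻¹ (τ⁻¹ p))) := fun p => rfl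
  refine halfCommute_of_cycle_word hx _ _ fun U V hU hV p q r =>
    hρ.cycle_word hx hd hf hn ?_ ?_ ?_ ?_ U V hU hV p q r
  · rw [happ, hτi _ hd, perm_inv_apply, hσc _ hf]
  · have h1 : c < τ⁻¹ c := lt_of_le_of_ne (hτge c le_rfl) fun h => hτ' (by
      conv_lhs => rw [h]
      simp)
    rw [happ, hσi _ h1, perm_apply_inv]
  · have h1 : σ⁻¹ c < c := lt_of_le_of_ne (hσle c le_rfl) fun h => hσ' (by
      conv_lhs => rw [← h]
      simp)
    rw [happ, perm_inv_apply, hτc _ h1, perm_apply_inv]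
  · intro p h1 h2 h3
    rw [happ]
    rcases lt_or_gt_of_ne h2 with h | h
    · have h4 : σ⁻¹ p < c := lt_of_le_of_ne (hσle p h.le) fun h5 => h1 (by rw [← h5]; simp)
      rw [hτi p h, hτc _ h4, perm_apply_inv]
    · have h4 : c < τ⁻¹ p := lt_of_le_of_ne (hτge p h.le) fun h5 => h3 (by rw [h5]; simp)
      rw [hσi _ h4, perm_apply_inv, hσc p h]

/-- The relations of a nontrivial permutation imply half-commutation. -/
theorem Rel.halfCommute (hx : ∑ i, x i * x i = 1) {n : ℕ} {σ : Perm ℕ} (h : Rel x n σ)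
    (hfix : ∀ p, n ≤ p → σ p = p) (hσ : σ ≠ 1) : HalfCommute x := by
  classical
  have hne : ∃ p, σ p ≠ p := by
    by_contra hc
    push Not at hc
    exact hσ (Equiv.ext hc)
  have hbd : ∃ m, ∀ p, m ≤ p → σ p = p := ⟨n, hfix⟩
  obtain ⟨c, hc, hc'⟩ : ∃ c, σ c ≠ c ∧ ∀ p, c < p → σ p = p := by
    rcases hM : Nat.find hbd with _ | c
    · obtain ⟨p, hp⟩ := hne
      exact absurd (Nat.find_spec hbd p (by omega)) hp
    · refine ⟨c, fun hc => ?_, fun p hp => Nat.find_spec hbd p (by omega)⟩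
      refine Nat.find_min hbd (m := c) (by omega) fun p hp => ?_
      rcases eq_or_lt_of_le hp with rfl | hp
      · exact hc
      · exact Nat.find_spec hbd p (by omega)
  obtain ⟨a, ha, ha'⟩ : ∃ a, σ a ≠ a ∧ ∀ p, p < a → σ p = p :=
    ⟨Nat.find hne, Nat.find_spec hne, fun p hp => by simpa using Nat.find_min hne hp⟩
  have hac : a ≤ c := by
    by_contra hlt
    exact ha (hc' a (by omega))
  have hcn : c < n := by
    by_contra hlt
    exact hc (hfix c (by omega))
  -- Here `a` and `c` are the first and last moved points. Translating by `c - a` puts the first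
  -- moved point of the translate at `c`, so the two supports meet only there.
  have hcs : shiftPerm (c - a) σ c = c - a + σ a := by
    have h := shiftPerm_add (c - a) σ a
    rwa [Nat.sub_add_cancel hac] at h
  have hsn : σ a < n := by
    by_contra hlt
    exact ha (σ.injective (hfix _ (not_lt.1 hlt)))
  refine Rel.halfCommute_of_overlap hx (c := c) (h.mono hfix (Nat.le_add_left n (c - a)))
    (h.shift (c - a)) hc' (fun p hp => ?_) hc (by omega) (by omega)
  by_cases hpc : p < c - a
  · exact shiftPerm_of_lt _ hpc
  · obtain ⟨q, rfl⟩ := Nat.exists_eq_add_of_le (not_lt.1 hpc)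
    rw [shiftPerm_add, ha' q (by omega)]

/-- The relations of a permutation that does not preserve the parity imply commutation. -/
theorem Rel.pairwiseCommute (hx : ∑ i, x i * x i = 1) {n : ℕ} {σ : Perm ℕ} (h : Rel x n σ)
    (hfix : ∀ p, n ≤ p → σ p = p) {p : ℕ} (hp : σ p % 2 ≠ p % 2) : PairwiseCommute x := by
  have hhalf := h.halfCommute hx hfix (by rintro rfl; simp at hp)
  have hpn : p < n := by
    by_contra hc
    rw [hfix p (not_lt.1 hc)] at hp
    exact hp rfl
  have hsn : σ p < n := by
    by_contra hc
    have := σ.injective (hfix _ (not_lt.1 hc))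
    rw [this] at hp
    exact hp rfl
  -- One of the positions `n`, `n + 1`, both fixed by `σ`, has the parity of `p`; the transposition
  -- of `p` and `q` then follows from half-commutation.
  obtain ⟨q, hq, hq2, hqp⟩ : ∃ q, n ≤ q ∧ q < n + 2 ∧ q % 2 = p % 2 := by
    by_cases hc : n % 2 = p % 2
    · exact ⟨n, by omega, by omega, hc⟩
    · exact ⟨n + 1, by omega, by omega, by omega⟩
  have h1 : Rel x (n + 2) (swap p q) := rel_swap (by omega) hq2 fun U r s hU =>
    hhalf.swap_word U (by rw [hU, Nat.odd_iff]; omega) r s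
  have h2 := h.mono hfix (Nat.le_add_right n 2)
  -- Conjugation by `σ` turns this into the transposition of `σ p` and `q`, which have opposite
  -- parities. The gap is now even and can be capped down to nothing.
  have h3 := (h2.mul h1).mul h2.inv
  rw [← Equiv.swap_apply_apply, hfix q hq] at h3
  intro r s
  let f (r s : ι) : A →+ A := AddMonoidHom.mk' (fun w => x r * w * x s) (by intros; noncomm_ring)
  have := eq_of_capped hx (n := 0) (f r s) (f s r) ((q - σ p - 1) / 2)
    (fun U hU => h3.swap_word hx (by omega) hq2 U (by omega) r s) [] rfl
  simpa [f] using this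

end Classification

/-! ### Transfer from permutations of `ℕ` to permutations of `Fin k`. -/

section FiniteWords

variable {ι A : Type*} [Ring A] (x : ι → A)

/-- The relations associated to a permutation of `k` letters. -/
def FinRel {k : ℕ} (σ : Perm (Fin k)) : Prop :=
  ∀ i : Fin k → ι, (List.ofFn fun p => x (i p)).prod = (List.ofFn fun p => x (i (σ p))).prod

/-- The permutation of the integers that extends a permutation of `k` letters. -/
def natPerm {k : ℕ} (σ : Perm (Fin k)) : Perm ℕ := σ.extendDomain Fin.equivSubtype

theorem natPerm_val {k : ℕ} (σ : Perm (Fin k)) (p : Fin k) : natPerm σ p = σ p :=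
  Perm.extendDomain_apply_image σ Fin.equivSubtype p

theorem natPerm_of_le {k : ℕ} (σ : Perm (Fin k)) (p : ℕ) (hp : k ≤ p) : natPerm σ p = p :=
  Perm.extendDomain_apply_not_subtype _ _ (by omega)

/-- A permutation that preserves the parity of the positions. -/
def PreservesParity {k : ℕ} (σ : Perm (Fin k)) : Prop := ∀ p, (σ p : ℕ) % 2 = (p : ℕ) % 2

variable {x}

theorem finRel_iff_rel {k : ℕ} (σ : Perm (Fin k)) : FinRel x σ ↔ Rel x k (natPerm σ) := by
  have hword : ∀ i : ℕ → ι, word x ((List.range k).map i) =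
      (List.ofFn fun p : Fin k => x (i p)).prod := fun i => by
    rw [word, List.map_map, List.ofFn_eq_map, ← List.map_coe_finRange_eq_range, List.map_map]
    rfl
  constructor
  · intro h i
    rw [hword, hword, h fun p => i p]
    simp only [Function.comp_apply, natPerm_val]
  · intro h i
    rcases k with _ | k
    · simp
    -- The value `i 0` beyond the word is arbitrary; with no letters there may be none to choose,
    -- hence the separate case `k = 0`.
    · have := h fun m => if hm : m < k + 1 then i ⟨m, hm⟩ else i 0
      rw [hword, hword] at this
      simpa only [Function.comp_apply, natPerm_val, Fin.is_lt, dite_true, Fin.eta] using this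

theorem FinRel.of_pairwiseCommute (h : PairwiseCommute x) {k : ℕ} (σ : Perm (Fin k)) :
    FinRel x σ := fun i => by
  have hp := Perm.ofFn_comp_perm σ fun p => x (i p)
  refine (List.Perm.prod_eq' hp ?_).symm
  refine List.pairwise_of_forall_mem_list fun a ha b hb => ?_
  obtain ⟨p, rfl⟩ := List.mem_ofFn.1 ha
  obtain ⟨q, rfl⟩ := List.mem_ofFn.1 hb
  exact h _ _

theorem FinRel.of_halfCommute (h : HalfCommute x) {k : ℕ} {σ : Perm (Fin k)}
    (hσ : PreservesParity σ) : FinRel x σ := by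
  refine (finRel_iff_rel σ).2 (h.rel k _ (natPerm_of_le σ) fun p => ?_)
  by_cases hp : p < k
  · have := natPerm_val σ ⟨p, hp⟩
    simp only at this
    rw [this, hσ ⟨p, hp⟩]
  · rw [natPerm_of_le σ p (not_lt.1 hp)]

variable [Fintype ι]

theorem FinRel.halfCommute (hx : ∑ i, x i * x i = 1) {k : ℕ} {σ : Perm (Fin k)}
    (h : FinRel x σ) (hσ : σ ≠ 1) : HalfCommute x :=
  ((finRel_iff_rel σ).1 h).halfCommute hx (natPerm_of_le σ) fun h1 =>
    hσ (Perm.extendDomain_eq_one_iff.1 h1)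

theorem FinRel.pairwiseCommute (hx : ∑ i, x i * x i = 1) {k : ℕ} {σ : Perm (Fin k)}
    (h : FinRel x σ) (hσ : ¬ PreservesParity σ) : PairwiseCommute x := by
  simp only [PreservesParity, not_forall] at hσ
  obtain ⟨p, hp⟩ := hσ
  exact ((finRel_iff_rel σ).1 h).pairwiseCommute hx (natPerm_of_le σ) (p := p)
    (by rwa [natPerm_val])

end FiniteWords

/-! ### Noncrossing words in symmetries. -/

section NoncrossingWords

variable {ι C : Type*} [Ring C] {u : ι → C}

/-- Split the word as `s A s B` at the next occurrence of its first letter. A letter common to `A`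
and `B` would cross `s`, so `A` and `B` separately have even multiplicities, and by induction both
evaluate to `1`. -/
theorem word_eq_one_of_noncrossing [DecidableEq ι] (hu : ∀ i, u i * u i = 1) (L : List ι)
    (hnc : ∀ p q, [p, q, p, q].Sublist L → p = q) (hev : ∀ p, Even (L.count p)) :
    word u L = 1 := by
  induction hn : L.length using Nat.strong_induction_on generalizing L with
  | _ n ih =>
  rcases L with _ | ⟨s, T⟩
  · rfl
  have hs : s ∈ T := by
    by_contra hc
    have := hev s
    rw [List.count_cons_self, List.count_eq_zero_of_not_mem hc] at this
    simp at this
  obtain ⟨A, B, rfl, hA⟩ : ∃ A B, T = A ++ s :: B ∧ s ∉ A := List.eq_append_cons_of_mem hs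
  have hAB : ∀ m ∈ A, m ∉ B := fun m hmA hmB => by
    have h1 : [s, m, s, m].Sublist (s :: (A ++ s :: B)) := by
      have h2 : [m].Sublist A := List.singleton_sublist.2 hmA
      have h3 : [m].Sublist B := List.singleton_sublist.2 hmB
      exact (h2.append (h3.cons_cons s)).cons_cons s
    exact hA (hnc s m h1 ▸ hmA)
  have hcount : ∀ p, (s :: (A ++ s :: B)).count p =
      A.count p + B.count p + 2 * (if s = p then 1 else 0) := fun p => by
    simp only [List.count_cons, List.count_append, beq_iff_eq]
    ring
  have hevA : ∀ p, Even (A.count p) := fun p => by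
    by_cases hp : p ∈ A
    · have := hev p
      rw [hcount, List.count_eq_zero_of_not_mem (hAB p hp), add_zero, Nat.even_add] at this
      simpa only [even_two, Even.mul_right, iff_true] using this
    · rw [List.count_eq_zero_of_not_mem hp]
      exact Even.zero
  have hevB : ∀ p, Even (B.count p) := fun p => by
    have h1 := hev p
    have h2 := hevA p
    rw [hcount, Nat.even_add, Nat.even_add] at h1
    simp only [even_two, Even.mul_right, iff_true] at h1
    exact h1.1 h2
  have hAL : A.Sublist (s :: (A ++ s :: B)) :=
    (List.sublist_append_left A (s :: B)).cons s
  have hBL : B.Sublist (s :: (A ++ s :: B)) :=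
    (((List.Sublist.refl B).cons s).trans (List.sublist_append_right A (s :: B))).cons s
  have hA1 := ih A.length (by simp at hn; omega) A (fun p q h => hnc p q (h.trans hAL)) hevA rfl
  have hB1 := ih B.length (by simp at hn; omega) B (fun p q h => hnc p q (h.trans hBL)) hevB rfl
  simp [hA1, hB1, hu]

theorem word_reverse_mul_word (hu : ∀ i, u i * u i = 1) (L : List ι) :
    word u L.reverse * word u L = 1 := by
  induction L with
  | nil => simp
  | cons s T ih =>
    rw [List.reverse_cons, word_append, word_cons, word_cons, word_nil, mul_one, mul_assoc,
      ← mul_assoc (u s), hu, one_mul, ih]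

theorem word_mul_word_reverse (hu : ∀ i, u i * u i = 1) (L : List ι) :
    word u L * word u L.reverse = 1 := by
  simpa using word_reverse_mul_word hu L.reverse

end NoncrossingWords

/-! ### The signature as a reordering sign. -/

section Switches

variable {k l N : ℕ}

theorem ofFn_comp_swap {α : Type*} (f : Fin k → α) (p q : Fin k) (hpq : (p : ℕ) + 1 = q) :
    ∃ P Q, List.ofFn f = P ++ f p :: f q :: Q ∧ List.ofFn (f ∘ swap p q) = P ++ f q :: f p :: Q := by
  refine ⟨(List.ofFn f).take p, (List.ofFn f).drop (p + 2), ?_, ?_⟩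
  · apply List.ext_getElem
    · simp; omega
    · intro n h1 h2
      simp only [List.getElem_ofFn, List.getElem_append, List.getElem_cons, List.getElem_take,
        List.getElem_drop]
      simp only [List.length_take, List.length_ofFn]
      split_ifs <;> congr 1 <;> apply Fin.ext <;> simp <;> omega
  · apply List.ext_getElem
    · simp; omega
    · intro n h1 h2
      simp only [List.getElem_ofFn, List.getElem_append, List.getElem_cons, List.getElem_take,
        List.getElem_drop, Function.comp_apply]
      simp only [List.length_take, List.length_ofFn]
      rw [swap_apply_def]
      simp only [List.length_ofFn] at h1
      simp only [Fin.ext_iff]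
      split_ifs <;> first | omega | (congr 1 <;> apply Fin.ext <;> simp <;> omega)

/-- The indices of a two-row multi-index, read clockwise from top left. -/
def clockwiseWord (i : Fin k → Fin N) (j : Fin l → Fin N) : List (Fin N) :=
  List.ofFn i ++ (List.ofFn j).reverse

theorem comap_kernel_upper (i : Fin k → Fin N) (j : Fin l → Fin N) (p q : Fin k) :
    (kernel i j).comap (swap (Sum.inl p) (Sum.inl q)) = kernel (i ∘ swap p q) j := by
  have h : Sum.elim i j ∘ swap (Sum.inl p) (Sum.inl q) = Sum.elim (i ∘ swap p q) j := by
    ext a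
    rcases a with a | a
    · simp only [Function.comp_apply, swap_apply_def, Sum.inl.injEq, Sum.elim_inl]
      split_ifs <;> simp
    · simp [swap_apply_def]
  rw [kernel, kernel, ← h]
  rfl

theorem comap_kernel_lower (i : Fin k → Fin N) (j : Fin l → Fin N) (p q : Fin l) :
    (kernel i j).comap (swap (Sum.inr p) (Sum.inr q)) = kernel i (j ∘ swap p q) := by
  have h : Sum.elim i j ∘ swap (Sum.inr p) (Sum.inr q) = Sum.elim i (j ∘ swap p q) := by
    ext a
    rcases a with a | a
    · simp [swap_apply_def]
    · simp only [Function.comp_apply, swap_apply_def, Sum.inr.injEq, Sum.elim_inr]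
      split_ifs <;> simp
  rw [kernel, kernel, ← h]
  rfl

/-- A switch of neighboring legs in different blocks exchanges two distinct adjacent letters of the
clockwise word, which costs one sign. Kernels remain kernels and the multiplicities of letters do
not change. -/
theorem SwitchesTo.exists_kernel {C : Type*} [Ring C] {u : Fin N → C}
    (hu : ∀ i j, i ≠ j → u i * u j = -(u j * u i)) {c : ℕ} {π ρ : Setoid (Fin k ⊕ Fin l)}
    (h : SwitchesTo c π ρ) (i : Fin k → Fin N) (j : Fin l → Fin N) (hπ : π = kernel i j) :
    ∃ (i' : Fin k → Fin N) (j' : Fin l → Fin N), ρ = kernel i' j' ∧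
      word u (clockwiseWord i j) = (-1) ^ c * word u (clockwiseWord i' j') ∧
      (clockwiseWord i j).Perm (clockwiseWord i' j') := by
  induction h generalizing i j with
  | refl π => exact ⟨i, j, hπ, by simp, List.Perm.refl _⟩
  | @upper c π ρ p q hpq hblock h ih =>
    subst hπ
    obtain ⟨i', j', h1, h2, h3⟩ := ih (i ∘ swap p q) j (comap_kernel_upper i j p q)
    obtain ⟨P, Q, hP, hQ⟩ := ofFn_comp_swap i p q hpq
    refine ⟨i', j', h1, ?_, List.Perm.trans ?_ h3⟩
    · rw [pow_succ, mul_assoc, ← neg_eq_neg_one_mul, mul_neg, ← h2]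
      simp only [clockwiseWord, hP, hQ, word_append, word_cons]
      rw [← mul_assoc (u (i p)), hu (i p) (i q) hblock]
      noncomm_ring
    · simp only [clockwiseWord, hP, hQ]
      exact ((List.Perm.swap _ _ _).append_left P).append_right _
  | @lower c π ρ p q hpq hblock h ih =>
    subst hπ
    obtain ⟨i', j', h1, h2, h3⟩ := ih i (j ∘ swap p q) (comap_kernel_lower i j p q)
    obtain ⟨P, Q, hP, hQ⟩ := ofFn_comp_swap j p q hpq
    refine ⟨i', j', h1, ?_, List.Perm.trans ?_ h3⟩
    · rw [pow_succ, mul_assoc, ← neg_eq_neg_one_mul, mul_neg, ← h2]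
      simp only [clockwiseWord, hP, hQ, word_append, word_cons, List.reverse_append,
        List.reverse_cons, List.append_assoc, word_nil, mul_one]
      rw [← mul_assoc (u (j q)), ← mul_assoc (u (j p)), hu (j p) (j q) hblock]
      noncomm_ring
    · simp only [clockwiseWord, hP, hQ]
      refine List.Perm.append_left _ (List.Perm.trans (List.reverse_perm _) ?_)
      exact (((List.Perm.swap _ _ _).append_left P)).trans (List.reverse_perm _).symm

/-- Read clockwise, the indices increase along the upper row and then decrease along the lower one.
Hence a letter between two equal ones is at least as large, and in a crossing this inequality holds
both ways. -/
theorem isNoncrossing_kernel_of_monotone {i : Fin k → Fin N} {j : Fin l → Fin N}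
    (hi : Monotone i) (hj : Monotone j) : IsNoncrossing (kernel i j) := by
  have huni : ∀ a b c : Fin k ⊕ Fin l, clockwise a < clockwise b → clockwise b < clockwise c →
      Sum.elim i j a = Sum.elim i j c → Sum.elim i j a ≤ Sum.elim i j b := by
    intro a b c hab hbc hac
    rcases b with b | b
    · rcases a with a | a
      · exact hi (Fin.le_def.2 (Nat.le_of_lt hab))
      · simp only [clockwise] at hab
        omega
    · rw [hac]
      rcases c with c | c
      · simp only [clockwise] at hbc
        omega
      · simp only [clockwise, Fin.val_rev] at hbc
        exact hj (Fin.le_def.2 (by omega))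
  intro a b c d hab hbc hcd hac hbd
  have h1 := huni a b c hab hbc hac
  have h2 := huni b c d hbc hcd hbd
  have hac' : Sum.elim i j a = Sum.elim i j c := hac
  exact le_antisymm h1 (hac' ▸ h2)

theorem exists_descent {i : Fin k → Fin N} (hi : ¬ Monotone i) :
    ∃ p q : Fin k, (p : ℕ) + 1 = q ∧ i q < i p := by
  by_contra hc
  push Not at hc
  refine hi ?_
  rcases k with _ | k
  · exact Subsingleton.monotone i
  · exact Fin.monotone_iff_le_succ.2 fun p => hc _ _ (by simp)

theorem toLex_comp_swap_lt {i : Fin k → Fin N} {p q : Fin k} (hpq : (p : ℕ) + 1 = q)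
    (h : i q < i p) : toLex (i ∘ swap p q) < toLex i := by
  refine ⟨p, fun r hr => ?_, ?_⟩
  · have h1 : r ≠ p := ne_of_lt hr
    have h2 : r ≠ q := fun h => by
      have := Fin.lt_def.1 hr
      rw [h] at this
      omega
    simp [swap_apply_of_ne_of_ne h1 h2]
  · simpa using h

/-- Bubble sort: switching at a descent decreases the row lexicographically, so one can sort the
upper row, then the lower one, and end at a noncrossing kernel. -/
theorem exists_switchesTo_noncrossing (i : Fin k → Fin N) (j : Fin l → Fin N) :
    ∃ c ρ, SwitchesTo c (kernel i j) ρ ∧ IsNoncrossing ρ := by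
  generalize hI : toLex i = I
  induction I using WellFoundedLT.induction generalizing i with
  | _ I ih =>
  subst hI
  by_cases hi : Monotone i
  · generalize hJ : toLex j = J
    clear ih
    induction J using WellFoundedLT.induction generalizing j with
    | _ J ih =>
    subst hJ
    by_cases hj : Monotone j
    · exact ⟨0, _, SwitchesTo.refl _, isNoncrossing_kernel_of_monotone hi hj⟩
    · obtain ⟨p, q, hpq, h⟩ := exists_descent hj
      obtain ⟨c, ρ, h1, h2⟩ := ih _ (toLex_comp_swap_lt hpq h) (j ∘ swap p q) rfl
      rw [← comap_kernel_lower] at h1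
      exact ⟨c + 1, ρ, SwitchesTo.lower p q hpq (fun hpq => h.ne' hpq) h1, h2⟩
  · obtain ⟨p, q, hpq, h⟩ := exists_descent hi
    obtain ⟨c, ρ, h1, h2⟩ := ih _ (toLex_comp_swap_lt hpq h) (i ∘ swap p q) rfl
    rw [← comap_kernel_upper] at h1
    exact ⟨c + 1, ρ, SwitchesTo.upper p q hpq (fun hpq => h.ne' hpq) h1, h2⟩

theorem exists_leg (i : Fin k → Fin N) (j : Fin l → Fin N) (m : ℕ)
    (hm : m < (clockwiseWord i j).length) :
    ∃ a : Fin k ⊕ Fin l, clockwise a = m ∧ Sum.elim i j a = (clockwiseWord i j)[m] := by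
  have hm' : m < k + l := by simpa [clockwiseWord] using hm
  by_cases h : m < k
  · exact ⟨Sum.inl ⟨m, h⟩, rfl, by simp [clockwiseWord, h]⟩
  · refine ⟨Sum.inr (Fin.rev ⟨m - k, by omega⟩), ?_, ?_⟩
    · simp only [clockwise, Fin.rev_rev]
      omega
    · simp only [clockwiseWord, List.getElem_append, List.length_ofFn, h, dite_false,
        List.getElem_reverse, List.getElem_ofFn, Sum.elim_inr]
      congr 1
      apply Fin.ext
      simp
      omega

theorem IsNoncrossing.sublist {i : Fin k → Fin N} {j : Fin l → Fin N}
    (h : IsNoncrossing (kernel i j)) (p q : Fin N)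
    (hs : [p, q, p, q].Sublist (clockwiseWord i j)) : p = q := by
  obtain ⟨f, hf⟩ := List.sublist_iff_exists_fin_orderEmbedding_get_eq.1 hs
  obtain ⟨a, ha, ha'⟩ := exists_leg i j _ (f ⟨0, by simp⟩).2
  obtain ⟨b, hb, hb'⟩ := exists_leg i j _ (f ⟨1, by simp⟩).2
  obtain ⟨c, hc, hc'⟩ := exists_leg i j _ (f ⟨2, by simp⟩).2
  obtain ⟨d, hd, hd'⟩ := exists_leg i j _ (f ⟨3, by simp⟩).2
  have h0 : Sum.elim i j a = p := ha'.trans (hf ⟨0, by simp⟩).symm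
  have h1 : Sum.elim i j b = q := hb'.trans (hf ⟨1, by simp⟩).symm
  have h2 : Sum.elim i j c = p := hc'.trans (hf ⟨2, by simp⟩).symm
  have h3 : Sum.elim i j d = q := hd'.trans (hf ⟨3, by simp⟩).symm
  have := h a b c d (by rw [ha, hb]; exact f.lt_iff_lt.2 (by simp))
    (by rw [hb, hc]; exact f.lt_iff_lt.2 (by simp [Fin.lt_def]))
    (by rw [hc, hd]; exact f.lt_iff_lt.2 (by simp))
    (h0.trans h2.symm) (h1.trans h3.symm)
  exact h0.symm.trans (Eq.trans this h1)

/-- The signature of a kernel is computed by anticommuting symmetries. -/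
theorem intCast_signature_kernel {C : Type*} [Ring C] {u : Fin N → C} (hu1 : ∀ i, u i * u i = 1)
    (hu : ∀ i j, i ≠ j → u i * u j = -(u j * u i)) (i : Fin k → Fin N) (j : Fin l → Fin N)
    (hev : ∀ p, Even ((clockwiseWord i j).count p)) :
    ((signature (kernel i j) : ℤ) : C) = word u (clockwiseWord i j) := by
  have key : ∀ c ρ, SwitchesTo c (kernel i j) ρ → IsNoncrossing ρ →
      word u (clockwiseWord i j) = (-1) ^ c := fun c ρ h1 h2 => by
    obtain ⟨i', j', rfl, h3, h4⟩ := h1.exists_kernel hu i j rfl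
    rw [h3, word_eq_one_of_noncrossing hu1 _ h2.sublist fun p => h4.count_eq p ▸ hev p, mul_one]
  rw [signature]
  split_ifs with h
  · obtain ⟨c, ρ, hc, h1, h2⟩ := h
    rw [key c ρ h1 h2, hc.neg_one_pow]
    simp
  -- The value `-1` is a default when no even number of switches works. Since some sequence of
  -- switches exists, it has odd length, so the default is the correct sign.
  · obtain ⟨c, ρ, h1, h2⟩ := exists_switchesTo_noncrossing i j
    have hc : Odd c := Nat.not_even_iff_odd.1 fun hc => h ⟨c, ρ, hc, h1, h2⟩
    rw [key c ρ h1 h2, hc.neg_one_pow]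
    simp

/-- The clockwise word of `(i, i ∘ σ)` is the word of `i` followed by the reversed word of `i ∘ σ`.
For symmetries reversal is inversion, so its value, the signature, is the quotient of the two words.
-/
theorem word_eq_signature_mul {C : Type*} [Ring C] {u : Fin N → C} (hu1 : ∀ i, u i * u i = 1)
    (hu : ∀ i j, i ≠ j → u i * u j = -(u j * u i)) (i : Fin k → Fin N) (σ : Perm (Fin k)) :
    word u (List.ofFn i) = (signature (kernel i (i ∘ σ)) : C) * word u (List.ofFn (i ∘ σ)) := by
  rw [intCast_signature_kernel hu1 hu, clockwiseWord, word_append, mul_assoc,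
    word_reverse_mul_word hu1, mul_one]
  intro p
  rw [clockwiseWord, List.count_append, List.count_reverse, (σ.ofFn_comp_perm i).count_eq]
  exact ⟨_, rfl⟩

theorem signature_mul_self (π : Setoid (Fin k ⊕ Fin l)) : signature π * signature π = 1 := by
  rw [signature]
  split_ifs <;> rfl

end Switches

/-! ### Sets of relations. -/

section Trichotomy

variable {ι A : Type*} [Ring A] [Fintype ι] {x : ι → A}

theorem forall_finRel_iff_halfCommute (hx : ∑ i, x i * x i = 1) {E : Set Permutation}
    (hE : ∀ σ ∈ E, PreservesParity σ.2) (hE' : ∃ σ ∈ E, σ.2 ≠ 1) :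
    (∀ σ ∈ E, FinRel x σ.2) ↔ HalfCommute x := by
  refine ⟨fun h => ?_, fun h σ hσ => FinRel.of_halfCommute h (hE σ hσ)⟩
  obtain ⟨σ, hσ, hσ'⟩ := hE'
  exact (h σ hσ).halfCommute hx hσ'

theorem forall_finRel_iff_pairwiseCommute (hx : ∑ i, x i * x i = 1) {E : Set Permutation}
    (hE : ∃ σ ∈ E, ¬ PreservesParity σ.2) :
    (∀ σ ∈ E, FinRel x σ.2) ↔ PairwiseCommute x := by
  refine ⟨fun h => ?_, fun h σ _ => FinRel.of_pairwiseCommute h σ.2⟩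
  obtain ⟨σ, hσ, hσ'⟩ := hE
  exact (h σ hσ).pairwiseCommute hx hσ'

end Trichotomy

/-! ### Twisting by a Clifford algebra. -/

section Twist

variable {N : ℕ}

/-- The Clifford algebra generated by `N` anticommuting symmetries. -/
abbrev Clifford (N : ℕ) : Type :=
  CliffordAlgebra (QuadraticMap.weightedSumSquares ℂ (fun _ : Fin N => (1 : ℂ)))

/-- The standard generators of the Clifford algebra. -/
noncomputable def gen (i : Fin N) : Clifford N := CliffordAlgebra.ι _ (Pi.single i 1)

theorem gen_mul_self (i : Fin N) : gen i * gen i = 1 := by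
  rw [gen, CliffordAlgebra.ι_sq_scalar]
  simp [QuadraticMap.weightedSumSquares_apply, Pi.single_apply]

theorem gen_mul_gen {i j : Fin N} (hij : i ≠ j) : gen i * gen j = -(gen j * gen i) := by
  rw [gen, gen, CliffordAlgebra.ι_mul_ι_comm_of_isOrtho]
  simp only [QuadraticMap.isOrtho_def, QuadraticMap.weightedSumSquares_apply, Pi.add_apply,
    ← Finset.sum_add_distrib]
  refine Finset.sum_congr rfl fun k _ => ?_
  by_cases hi : k = i
  · subst hi
    simp [hij]
  · simp [Pi.single_apply, hi]

variable {A : Type*} [Ring A] [Algebra ℂ A]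

/-- The twist of a family, by anticommuting symmetries. -/
noncomputable def twist (x : Fin N → A) (i : Fin N) : A ⊗[ℂ] Clifford N := x i ⊗ₜ gen i

theorem sum_twist_sq {x : Fin N → A} (hx : ∑ i, x i * x i = 1) :
    ∑ i, twist x i * twist x i = 1 := by
  simp only [twist, Algebra.TensorProduct.tmul_mul_tmul, gen_mul_self, ← TensorProduct.sum_tmul, hx]
  rfl

theorem word_twist (x : Fin N → A) (w : List (Fin N)) :
    word (twist x) w = word x w ⊗ₜ word gen w := by
  induction w with
  | nil => rfl
  | cons i w ih => simp [ih, twist]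

/-- A word in the generators is invertible, with its reversal as inverse, and `a ↦ a ⊗ 1` is
injective. -/
theorem tmul_word_gen_inj {a b : A} (w : List (Fin N))
    (h : a ⊗ₜ[ℂ] word gen w = b ⊗ₜ[ℂ] word gen w) : a = b := by
  have h1 := congrArg (· * (1 : A) ⊗ₜ[ℂ] word gen w.reverse) h
  simp only [Algebra.TensorProduct.tmul_mul_tmul, word_mul_word_reverse gen_mul_self, mul_one] at h1
  exact Algebra.TensorProduct.includeLeft_injective (R := ℂ) (S := ℂ) (A := A) (B := Clifford N)
    (algebraMap ℂ (Clifford N)).injective h1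

theorem intCast_tmul (s : ℤ) (a : A) (c : Clifford N) :
    a ⊗ₜ[ℂ] ((s : Clifford N) * c) = (s • a) ⊗ₜ[ℂ] c := by
  rw [← zsmul_eq_mul, ← Int.cast_smul_eq_zsmul ℂ, ← Int.cast_smul_eq_zsmul ℂ,
    TensorProduct.tmul_smul, TensorProduct.smul_tmul']

/-- Both words of the twist have Clifford factors that differ by the signature, which moves to the
other tensor factor; the remaining common factor cancels. This lets the untwisted classification be
applied to the twisted relations. -/
theorem finRel_twist_iff {x : Fin N → A} {k : ℕ} (σ : Perm (Fin k)) :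
    FinRel (twist x) σ ↔ ∀ i : Fin k → Fin N, (List.ofFn fun p => x (i p)).prod =
      signature (kernel i (i ∘ σ)) • (List.ofFn fun p => x (i (σ p))).prod := by
  have hword : ∀ {B : Type _} [Ring B] (y : Fin N → B) (i : Fin k → Fin N),
      (List.ofFn fun p => y (i p)).prod = word y (List.ofFn i) := fun y i => by
    rw [word, List.map_ofFn]
    rfl
  refine forall_congr' fun i => ?_
  have h1 := word_eq_signature_mul gen_mul_self (fun _ _ => gen_mul_gen) i σ
  have h2 : (List.ofFn fun p => x (i (σ p))).prod = word x (List.ofFn (i ∘ σ)) := hword x (i ∘ σ)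
  have h3 : (List.ofFn fun p => twist x (i (σ p))).prod = word (twist x) (List.ofFn (i ∘ σ)) := by
    rw [word, List.map_ofFn]
    rfl
  have h4 : (List.ofFn fun p => twist x (i p)).prod = word (twist x) (List.ofFn i) := by
    rw [word, List.map_ofFn]
    rfl
  rw [h2, h3, h4, hword x i, word_twist, word_twist, h1, intCast_tmul]
  constructor
  · intro h
    rw [← tmul_word_gen_inj _ h, smul_smul, signature_mul_self, one_smul]
  · intro h
    rw [h, smul_smul, signature_mul_self, one_smul]

theorem pairwiseCommute_twist_iff {x : Fin N → A} :
    PairwiseCommute (twist x) ↔ ∀ i j, i ≠ j → x i * x j = -(x j * x i) := by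
  have h : ∀ i j, i ≠ j → (twist x i * twist x j = twist x j * twist x i ↔
      x i * x j = -(x j * x i)) := fun i j hij => by
    simp only [twist, Algebra.TensorProduct.tmul_mul_tmul]
    rw [gen_mul_gen hij, TensorProduct.tmul_neg, ← TensorProduct.neg_tmul, neg_eq_iff_eq_neg.symm]
    have := tmul_word_gen_inj (a := -(x i * x j)) (b := x j * x i) [j, i]
    simp only [word_cons, word_nil, mul_one] at this
    exact ⟨this, fun h => by rw [h]⟩
  refine ⟨fun hc i j hij => (h i j hij).1 (hc i j), fun hc i j => ?_⟩
  rcases eq_or_ne i j with rfl | hij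
  · rfl
  · exact (h i j hij).2 (hc i j hij)

/-- Reversing `eᵢeⱼe_k` takes three anticommutations when the indices are distinct, hence a sign;
with a repetition the product is unchanged. -/
theorem halfCommute_twist_iff {x : Fin N → A} :
    HalfCommute (twist x) ↔
      (∀ i j k, (i ≠ j ∧ j ≠ k ∧ i ≠ k) → x i * x j * x k = -(x k * x j * x i)) ∧
      (∀ i j k, ¬ (i ≠ j ∧ j ≠ k ∧ i ≠ k) → x i * x j * x k = x k * x j * x i) := by
  have hinj : ∀ (a b : A) (i j k : Fin N), a ⊗ₜ[ℂ] (gen i * gen j * gen k) =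
      b ⊗ₜ[ℂ] (gen i * gen j * gen k) ↔ a = b := fun a b i j k => by
    have := tmul_word_gen_inj (a := a) (b := b) [i, j, k]
    simp only [word_cons, word_nil, mul_one, ← mul_assoc] at this
    exact ⟨this, fun h => by rw [h]⟩
  have h1 : ∀ i j k, (i ≠ j ∧ j ≠ k ∧ i ≠ k) →
      (twist x i * twist x j * twist x k = twist x k * twist x j * twist x i ↔
      x i * x j * x k = -(x k * x j * x i)) := fun i j k ⟨hij, hjk, hik⟩ => by
    have hg : (gen k * gen j * gen i : Clifford N) = -(gen i * gen j * gen k) := by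
      rw [gen_mul_gen hjk.symm, neg_mul, mul_assoc, gen_mul_gen hik.symm, mul_neg, ← mul_assoc,
        gen_mul_gen hij.symm, neg_mul, neg_neg]
    simp only [twist, Algebra.TensorProduct.tmul_mul_tmul]
    rw [hg, TensorProduct.tmul_neg, ← TensorProduct.neg_tmul, hinj]
  have h2 : ∀ i j k, ¬ (i ≠ j ∧ j ≠ k ∧ i ≠ k) →
      (twist x i * twist x j * twist x k = twist x k * twist x j * twist x i ↔
      x i * x j * x k = x k * x j * x i) := fun i j k h => by
    have hg : (gen k * gen j * gen i : Clifford N) = gen i * gen j * gen k := by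
      by_cases hij : i = j
      · subst hij
        rw [mul_assoc, gen_mul_self, mul_one, one_mul]
      by_cases hjk : j = k
      · subst hjk
        rw [gen_mul_self, one_mul, mul_assoc, gen_mul_self, mul_one]
      have hik : i = k := by tauto
      rw [hik]
    simp only [twist, Algebra.TensorProduct.tmul_mul_tmul]
    rw [hg, hinj]
  constructor
  · exact fun h => ⟨fun i j k hd => (h1 i j k hd).1 (h i j k),
      fun i j k hd => (h2 i j k hd).1 (h i j k)⟩
  · intro h i j k
    by_cases hd : i ≠ j ∧ j ≠ k ∧ i ≠ k
    · exact (h1 i j k hd).2 (h.1 i j k hd)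
    · exact (h2 i j k hd).2 (h.2 i j k hd)

end Twist

/-! ### Spheres as relations in quotient rings. -/

section Relations

variable {N : ℕ}

theorem mem_ofRelations {R : Set (FreeAlg N)} {r : FreeAlg N} :
    r ∈ (ofRelations R).ideal ↔
      ∀ I : TwoSidedIdeal (FreeAlg N), IsClosed (I : Set (FreeAlg N)) → R ⊆ I → r ∈ I := by
  simp only [ofRelations, TwoSidedIdeal.mem_sInf, Set.mem_ofPred_eq, and_imp]

theorem subset_ofRelations (R : Set (FreeAlg N)) : R ⊆ (ofRelations R).ideal :=
  fun _ hr => mem_ofRelations.2 fun _ _ h => h hr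

theorem ofRelations_ideal_le {R : Set (FreeAlg N)} {I : TwoSidedIdeal (FreeAlg N)}
    (hI : IsClosed (I : Set (FreeAlg N))) : (ofRelations R).ideal ≤ I ↔ R ⊆ I :=
  ⟨fun h => (subset_ofRelations R).trans h, fun h _ hr => mem_ofRelations.1 hr I hI h⟩

/-- Testing on the two ideals themselves gives both inclusions. All identifications of spheres
reduce to this test, where only the ring quotient by `I` is used. -/
theorem subspace_eq_of_forall {S T : Subspace N}
    (h : ∀ I : TwoSidedIdeal (FreeAlg N), IsClosed (I : Set (FreeAlg N)) →
      (S.ideal ≤ I ↔ T.ideal ≤ I)) : S = T :=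
  Subspace.ext (le_antisymm ((h T.ideal T.isClosed).2 le_rfl) ((h S.ideal S.isClosed).1 le_rfl))

theorem inter_ideal_le {S T : Subspace N} {I : TwoSidedIdeal (FreeAlg N)}
    (hI : IsClosed (I : Set (FreeAlg N))) :
    (inter S T).ideal ≤ I ↔ S.ideal ≤ I ∧ T.ideal ≤ I := by
  rw [inter, ofRelations_ideal_le hI, Set.union_subset_iff]
  rfl

/-- The coordinates, modulo an ideal. -/
noncomputable def coordMod (I : TwoSidedIdeal (FreeAlg N)) (i : Fin N) : I.ringCon.Quotient :=
  I.ringCon.mk' (coord i)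

theorem sum_coordMod_sq (I : TwoSidedIdeal (FreeAlg N)) :
    ∑ i, coordMod I i * coordMod I i = 1 := by
  simp only [coordMod, ← map_mul, ← map_sum, sum_coord_sq, map_one]

theorem mem_iff_mk_eq_zero (I : TwoSidedIdeal (FreeAlg N)) (r : FreeAlg N) :
    r ∈ I ↔ I.ringCon.mk' r = 0 := by
  rw [← TwoSidedIdeal.mem_ker, TwoSidedIdeal.ker_ringCon_mk']

theorem mk_monomial (I : TwoSidedIdeal (FreeAlg N)) {k : ℕ} (i : Fin k → Fin N) :
    I.ringCon.mk' (monomial i) = (List.ofFn fun p => coordMod I (i p)).prod := by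
  rw [monomial, map_list_prod, List.map_ofFn]
  rfl

theorem untwistedRel_subset_iff (I : TwoSidedIdeal (FreeAlg N)) {k : ℕ} (σ : Perm (Fin k)) :
    untwistedRel N σ ⊆ I ↔ FinRel (coordMod I) σ := by
  have h : ∀ i : Fin k → Fin N, monomial i - monomial (i ∘ σ) ∈ I ↔
      (List.ofFn fun p => coordMod I (i p)).prod =
        (List.ofFn fun p => coordMod I (i (σ p))).prod := fun i => by
    rw [mem_iff_mk_eq_zero, map_sub, sub_eq_zero, mk_monomial, mk_monomial]
    rfl
  refine ⟨fun hs i => (h i).1 (hs ⟨i, rfl⟩), ?_⟩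
  rintro hs _ ⟨i, rfl⟩
  exact (h i).2 (hs i)

theorem twistedRel_subset_iff (I : TwoSidedIdeal (FreeAlg N)) {k : ℕ} (σ : Perm (Fin k)) :
    twistedRel N σ ⊆ I ↔ FinRel (twist (coordMod I)) σ := by
  have h : ∀ i : Fin k → Fin N,
      monomial i - signature (kernel i (i ∘ σ)) • monomial (i ∘ σ) ∈ I ↔
      (List.ofFn fun p => coordMod I (i p)).prod = signature (kernel i (i ∘ σ)) •
        (List.ofFn fun p => coordMod I (i (σ p))).prod := fun i => by
    rw [mem_iff_mk_eq_zero, map_sub, sub_eq_zero, map_zsmul, mk_monomial, mk_monomial]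
    rfl
  rw [finRel_twist_iff]
  refine ⟨fun hs i => (h i).1 (hs ⟨i, rfl⟩), ?_⟩
  rintro hs _ ⟨i, rfl⟩
  exact (h i).2 (hs i)

theorem untwistedMonomial_ideal_le {I : TwoSidedIdeal (FreeAlg N)}
    (hI : IsClosed (I : Set (FreeAlg N))) (E : Set Permutation) :
    (untwistedMonomial N E).ideal ≤ I ↔ ∀ σ ∈ E, FinRel (coordMod I) σ.2 := by
  simp only [untwistedMonomial, ofRelations_ideal_le hI, Set.iUnion_subset_iff,
    untwistedRel_subset_iff]

theorem twistedMonomial_ideal_le {I : TwoSidedIdeal (FreeAlg N)}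
    (hI : IsClosed (I : Set (FreeAlg N))) (F : Set Permutation) :
    (twistedMonomial N F).ideal ≤ I ↔ ∀ σ ∈ F, FinRel (twist (coordMod I)) σ.2 := by
  simp only [twistedMonomial, ofRelations_ideal_le hI, Set.iUnion_subset_iff,
    twistedRel_subset_iff]

theorem freeSphere_ideal_le (I : TwoSidedIdeal (FreeAlg N)) (hI : IsClosed (I : Set (FreeAlg N))) :
    (freeSphere N).ideal ≤ I := (ofRelations_ideal_le hI).2 (Set.empty_subset _)

theorem halfSphere_ideal_le {I : TwoSidedIdeal (FreeAlg N)} (hI : IsClosed (I : Set (FreeAlg N))) :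
    (halfSphere N).ideal ≤ I ↔ HalfCommute (coordMod I) := by
  have h : ∀ i j k : Fin N, coord i * coord j * coord k - coord k * coord j * coord i ∈ I ↔
      coordMod I i * coordMod I j * coordMod I k = coordMod I k * coordMod I j * coordMod I i :=
    fun i j k => by
      rw [mem_iff_mk_eq_zero, map_sub, sub_eq_zero]
      rfl
  rw [halfSphere, ofRelations_ideal_le hI]
  refine ⟨fun hs i j k => (h i j k).1 (hs ⟨i, j, k, rfl⟩), ?_⟩
  rintro hs _ ⟨i, j, k, rfl⟩
  exact (h i j k).2 (hs i j k)

theorem twistedSphere_ideal_le {I : TwoSidedIdeal (FreeAlg N)}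
    (hI : IsClosed (I : Set (FreeAlg N))) :
    (twistedSphere N).ideal ≤ I ↔ PairwiseCommute (twist (coordMod I)) := by
  have h : ∀ i j : Fin N, coord i * coord j + coord j * coord i ∈ I ↔
      coordMod I i * coordMod I j = -(coordMod I j * coordMod I i) := fun i j => by
    rw [mem_iff_mk_eq_zero, map_add, add_eq_zero_iff_eq_neg]
    rfl
  rw [twistedSphere, ofRelations_ideal_le hI, pairwiseCommute_twist_iff]
  refine ⟨fun hs i j hij => (h i j).1 (hs ⟨i, j, hij, rfl⟩), ?_⟩
  rintro hs _ ⟨i, j, hij, rfl⟩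
  exact (h i j).2 (hs i j hij)

theorem twistedHalfSphere_ideal_le {I : TwoSidedIdeal (FreeAlg N)}
    (hI : IsClosed (I : Set (FreeAlg N))) :
    (twistedHalfSphere N).ideal ≤ I ↔ HalfCommute (twist (coordMod I)) := by
  have h1 : ∀ i j k : Fin N, coord i * coord j * coord k + coord k * coord j * coord i ∈ I ↔
      coordMod I i * coordMod I j * coordMod I k = -(coordMod I k * coordMod I j * coordMod I i) :=
    fun i j k => by
      rw [mem_iff_mk_eq_zero, map_add, add_eq_zero_iff_eq_neg]
      rfl
  have h2 : ∀ i j k : Fin N, coord i * coord j * coord k - coord k * coord j * coord i ∈ I ↔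
      coordMod I i * coordMod I j * coordMod I k = coordMod I k * coordMod I j * coordMod I i :=
    fun i j k => by
      rw [mem_iff_mk_eq_zero, map_sub, sub_eq_zero]
      rfl
  rw [twistedHalfSphere, ofRelations_ideal_le hI, halfCommute_twist_iff, Set.union_subset_iff]
  refine and_congr ⟨fun hs i j k hd => (h1 i j k).1 (hs ⟨i, j, k, hd, rfl⟩), ?_⟩
    ⟨fun hs i j k hd => (h2 i j k).1 (hs ⟨i, j, k, hd, rfl⟩), ?_⟩
  · rintro hs _ ⟨i, j, k, hd, rfl⟩
    exact (h1 i j k).2 (hs i j k hd)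
  · rintro hs _ ⟨i, j, k, hd, rfl⟩
    exact (h2 i j k).2 (hs i j k hd)

end Relations

/-! ### Quotients of C⋆-algebras. -/

section Quotient

variable {A : Type*} [CStarAlgebra A] (J : Ideal A) [J.IsTwoSided]

/-- The elements of an ideal have approximate right units in the ideal. -/
theorem exists_approximate_unit {a : A} (ha : a ∈ J) {ε : ℝ} (hε : 0 < ε) :
    ∃ e ∈ J, ‖1 - e‖ ≤ 1 ∧ ‖a * (1 - e)‖ ≤ ε := by
  -- With `h = a*a`, the unit is `e = h(h + δ)⁻¹`, so `1 - e = δ(h + δ)⁻¹`. Then `‖a(1 - e)‖²` is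
  -- the norm of `δ²h(h + δ)⁻²`, at most `δ`, which should be `ε²`.
  set δ : ℝ := ε ^ 2 with hδ
  have hδ0 : 0 < δ := by positivity
  have hsp := spectrum_star_mul_self_nonneg (b := a)
  set h : A := star a * a with hh
  have hsa : IsSelfAdjoint h := IsSelfAdjoint.star_mul_self a
  have hne : ∀ t ∈ spectrum ℝ h, t + δ ≠ 0 := fun t ht => by
    have := hsp t ht
    positivity
  have hc1 : ContinuousOn (fun t : ℝ => (t + δ)⁻¹) (spectrum ℝ h) :=
    ContinuousOn.inv₀ (by fun_prop) hne
  have hc2 : ContinuousOn (fun t : ℝ => δ * (t + δ)⁻¹) (spectrum ℝ h) :=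
    continuousOn_const.mul hc1
  have hc0 : ContinuousOn (fun t : ℝ => t) (spectrum ℝ h) := continuousOn_id
  have hc3 : ContinuousOn (fun t : ℝ => t * (t + δ)⁻¹) (spectrum ℝ h) := hc0.mul hc1
  have hc4 : ContinuousOn (fun t : ℝ => t * (δ * (t + δ)⁻¹)) (spectrum ℝ h) := hc0.mul hc2
  have he : 1 - h * cfc (fun t : ℝ => (t + δ)⁻¹) h = cfc (fun t : ℝ => δ * (t + δ)⁻¹) h := by
    rw [sub_eq_iff_eq_add]
    conv_rhs => enter [2, 1]; rw [← cfc_id' ℝ h]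
    rw [← cfc_mul (fun t : ℝ => t) _ h hc0 hc1, ← cfc_add (a := h) _ _ hc2 hc3, ← cfc_one ℝ h]
    refine cfc_congr fun t ht => ?_
    have := hne t ht
    simp only [Pi.one_apply]
    field_simp
    ring
  refine ⟨h * cfc (fun t : ℝ => (t + δ)⁻¹) h, ?_, ?_, ?_⟩
  · exact J.mul_mem_right _ (J.mul_mem_left _ ha)
  · rw [he]
    refine norm_cfc_le zero_le_one fun t ht => ?_
    have := hsp t ht
    rw [Real.norm_of_nonneg (by positivity), ← div_eq_mul_inv, div_le_one (by positivity)]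
    linarith
  · rw [he]
    set g := cfc (fun t : ℝ => δ * (t + δ)⁻¹) h with hg
    have hgs : star g = g := (cfc_predicate (R := ℝ) _ h : IsSelfAdjoint g).star_eq
    have h1 : star (a * g) * (a * g) =
        cfc (fun t : ℝ => (δ * (t + δ)⁻¹) * (t * (δ * (t + δ)⁻¹))) h := by
      rw [cfc_mul _ _ h hc2 hc4, cfc_mul _ _ h hc0 hc2,
        cfc_id' ℝ h, star_mul, hgs, hh]
      simp only [mul_assoc]
      rfl
    have h2 : ‖star (a * g) * (a * g)‖ ≤ δ := by
      rw [h1]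
      refine norm_cfc_le hδ0.le fun t ht => ?_
      have ht0 := hsp t ht
      rw [Real.norm_of_nonneg (by positivity)]
      have h3 : δ * (t + δ)⁻¹ * (t * (δ * (t + δ)⁻¹)) = δ * (δ * t / (t + δ) ^ 2) := by
        field_simp
      rw [h3]
      refine mul_le_of_le_one_right hδ0.le ((div_le_one (by positivity)).2 ?_)
      nlinarith
    rw [CStarRing.norm_star_mul_self] at h2
    nlinarith [norm_nonneg (a * g)]

variable [hJ : IsClosed (J : Set A)]

theorem norm_quotient_mk_le (a : A) : ‖(Ideal.Quotient.mk J a : A ⧸ J)‖ ≤ ‖a‖ :=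
  Submodule.Quotient.norm_mk_le J a

theorem norm_quotient_mul_le (x y : A ⧸ J) : ‖x * y‖ ≤ ‖x‖ * ‖y‖ := by
  have h : ∀ ε > 0, ‖x * y‖ ≤ (‖x‖ + ε) * (‖y‖ + ε) := fun ε hε => by
    obtain ⟨a, rfl, ha⟩ := Submodule.Quotient.norm_mk_lt x hε
    obtain ⟨b, rfl, hb⟩ := Submodule.Quotient.norm_mk_lt y hε
    calc _ ≤ ‖a * b‖ := norm_quotient_mk_le J (a * b)
      _ ≤ ‖a‖ * ‖b‖ := norm_mul_le a b
      _ ≤ _ := by gcongr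
  have hlim : Filter.Tendsto (fun ε : ℝ => (‖x‖ + ε) * (‖y‖ + ε)) (nhdsWithin 0 (Set.Ioi 0))
      (nhds (‖x‖ * ‖y‖)) := by
    have : Continuous fun ε : ℝ => (‖x‖ + ε) * (‖y‖ + ε) := by fun_prop
    simpa using (this.tendsto 0).mono_left nhdsWithin_le_nhds
  exact ge_of_tendsto hlim (Filter.eventually_of_mem self_mem_nhdsWithin h)

variable (hstar : ∀ a ∈ J, star a ∈ J)

/-- The involution of a quotient by a self-adjoint ideal. -/
@[reducible] noncomputable def quotientStarRing : StarRing (A ⧸ J) where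
  star := Quotient.map' (s₁ := Submodule.quotientRel J) (s₂ := Submodule.quotientRel J) star
    fun a b h => by
      rw [Submodule.quotientRel_def] at h ⊢
      rw [← star_sub]
      exact hstar _ h
  star_involutive x := by
    obtain ⟨a, rfl⟩ := Ideal.Quotient.mk_surjective x
    exact congrArg (Ideal.Quotient.mk J) (star_star a)
  star_mul x y := by
    obtain ⟨a, rfl⟩ := Ideal.Quotient.mk_surjective x
    obtain ⟨b, rfl⟩ := Ideal.Quotient.mk_surjective y
    exact congrArg (Ideal.Quotient.mk J) (star_mul a b)
  star_add x y := by
    obtain ⟨a, rfl⟩ := Ideal.Quotient.mk_surjective x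
    obtain ⟨b, rfl⟩ := Ideal.Quotient.mk_surjective y
    exact congrArg (Ideal.Quotient.mk J) (star_add a b)

/-- Lift the class of `a*a` to some `b` of nearly the same norm. Since `b - a*a` lies in `J`, an
approximate unit `e` makes it small: `a(1 - e)` has the class of `a`, and its squared norm is at
most `‖b‖` up to `ε/2`. -/
theorem norm_quotient_mk_mul_self_le (a : A) :
    ‖(Ideal.Quotient.mk J a : A ⧸ J)‖ * ‖(Ideal.Quotient.mk J a : A ⧸ J)‖ ≤
      ‖(Ideal.Quotient.mk J (star a * a) : A ⧸ J)‖ := by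
  refine le_of_forall_pos_le_add fun ε hε => ?_
  obtain ⟨b, hb, hb'⟩ := Submodule.Quotient.norm_mk_lt
    (Ideal.Quotient.mk J (star a * a) : A ⧸ J) (half_pos hε)
  have hi : b - star a * a ∈ J := Ideal.Quotient.eq.1 hb
  obtain ⟨e, he, he1, he2⟩ := exists_approximate_unit J hi (half_pos hε)
  have h1 : (Ideal.Quotient.mk J a : A ⧸ J) = Ideal.Quotient.mk J (a * (1 - e)) := by
    rw [Ideal.Quotient.eq, mul_sub, mul_one, sub_sub_cancel]
    exact J.mul_mem_left a he
  have h2 : star (a * (1 - e)) * (a * (1 - e)) =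
      star (1 - e) * b * (1 - e) - star (1 - e) * ((b - star a * a) * (1 - e)) := by
    rw [star_mul]
    noncomm_ring
  have h3 : ‖star (1 - e)‖ ≤ 1 := by rwa [norm_star]
  have h4 : ‖star (1 - e) * b * (1 - e)‖ ≤ ‖b‖ :=
    calc _ ≤ ‖star (1 - e)‖ * ‖b‖ * ‖1 - e‖ := norm_mul₃_le
      _ ≤ 1 * ‖b‖ * 1 := by gcongr
      _ = ‖b‖ := by ring
  have h5 : ‖star (1 - e) * ((b - star a * a) * (1 - e))‖ ≤ ε / 2 :=
    calc _ ≤ ‖star (1 - e)‖ * ‖(b - star a * a) * (1 - e)‖ := norm_mul_le _ _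
      _ ≤ 1 * (ε / 2) := by gcongr
      _ = ε / 2 := by ring
  calc _ ≤ ‖a * (1 - e)‖ * ‖a * (1 - e)‖ := by
        rw [h1]
        gcongr <;> exact norm_quotient_mk_le J _
    _ = ‖star (a * (1 - e)) * (a * (1 - e))‖ := CStarRing.norm_star_mul_self.symm
    _ ≤ ‖star (1 - e) * b * (1 - e)‖ + ‖star (1 - e) * ((b - star a * a) * (1 - e))‖ := by
        rw [h2]
        exact norm_sub_le _ _
    _ ≤ _ := by linarith

/-- The quotient of a C⋆-algebra by a self-adjoint closed ideal containing all the commutators. -/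
@[reducible] noncomputable def quotientCommCStarAlgebra
    (hcomm : ∀ a b : A, a * b - b * a ∈ J) : CommCStarAlgebra (A ⧸ J) :=
  letI ring : NormedCommRing (A ⧸ J) :=
    { Submodule.Quotient.normedAddCommGroup J, Ideal.Quotient.ring J with
      norm_mul_le := norm_quotient_mul_le J
      mul_comm := fun x y => by
        obtain ⟨a, rfl⟩ := Ideal.Quotient.mk_surjective x
        obtain ⟨b, rfl⟩ := Ideal.Quotient.mk_surjective y
        exact Ideal.Quotient.eq.2 (hcomm a b) }
  letI alg : NormedAlgebra ℂ (A ⧸ J) :=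
    { (inferInstance : Algebra ℂ (A ⧸ J)) with
      norm_smul_le := (Submodule.Quotient.normedSpace J ℂ).norm_smul_le }
  letI st : StarRing (A ⧸ J) := quotientStarRing J hstar
  { ring, alg, st with
    norm_mul_self_le := fun x => by
      obtain ⟨a, rfl⟩ := Ideal.Quotient.mk_surjective x
      exact norm_quotient_mk_mul_self_le J a
    star_smul := fun z x => by
      obtain ⟨a, rfl⟩ := Ideal.Quotient.mk_surjective x
      exact congrArg (Ideal.Quotient.mk J) (star_smul z a)
    toCompleteSpace := Submodule.Quotient.completeSpace J }

end Quotient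

/-! ### The classical sphere as an abelianization. -/

section RealSphere

variable {N : ℕ}

/-- The coordinates generate `C(S^{N-1}_{ℝ,+})`. -/
theorem eq_top_of_coord_mem (S : StarSubalgebra ℂ (FreeAlg N)) (hS : IsClosed (S : Set (FreeAlg N)))
    (h : ∀ i, coord i ∈ S) (a : FreeAlg N) : a ∈ S := by
  let f : FreeAlg N →⋆ₐ[ℂ] Ambient N := (freeSubalgebra N).subtype
  have hcl : IsClosed ((S.map f : StarSubalgebra ℂ (Ambient N)) : Set (Ambient N)) := by
    have hemb : Topology.IsClosedEmbedding (Subtype.val : freeSubalgebra N → Ambient N) :=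
      (inferInstance : IsClosed (freeSubalgebra N : Set (Ambient N))).isClosedEmbedding_subtypeVal
    exact hemb.isClosedMap _ hS
  have hle : freeSubalgebra N ≤ S.map f := by
    refine StarSubalgebra.topologicalClosure_minimal (StarAlgebra.adjoin_le ?_) hcl
    rintro _ ⟨i, rfl⟩
    exact ⟨coord i, h i, rfl⟩
  obtain ⟨b, hb, hba⟩ := hle a.2
  have : b = a := Subtype.ext hba
  exact this ▸ hb

/-- The elements that commute with all the elements of `T`, modulo an ideal. -/
def commutantMod (J : TwoSidedIdeal (FreeAlg N)) (hJ : ∀ a ∈ J, star a ∈ J) (T : Set (FreeAlg N))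
    (hT : ∀ b ∈ T, star b ∈ T) : StarSubalgebra ℂ (FreeAlg N) where
  carrier := {a | ∀ b ∈ T, a * b - b * a ∈ J}
  mul_mem' {a a'} ha ha' b hb := by
    have h : a * a' * b - b * (a * a') = a * (a' * b - b * a') + (a * b - b * a) * a' := by
      noncomm_ring
    rw [h]
    exact J.add_mem (J.mul_mem_left _ _ (ha' b hb)) (J.mul_mem_right _ _ (ha b hb))
  add_mem' {a a'} ha ha' b hb := by
    have h : (a + a') * b - b * (a + a') = (a * b - b * a) + (a' * b - b * a') := by
      noncomm_ring
    rw [h]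
    exact J.add_mem (ha b hb) (ha' b hb)
  algebraMap_mem' z b _ := by
    rw [Algebra.commutes, sub_self]
    exact J.zero_mem
  star_mem' {a} ha b hb := by
    have h : star a * b - b * star a = -star (a * star b - star b * a) := by
      simp
    rw [h]
    exact J.neg_mem (hJ _ (ha _ (hT b hb)))

theorem isClosed_commutantMod {J : TwoSidedIdeal (FreeAlg N)}
    (hcl : IsClosed (J : Set (FreeAlg N))) (hJ : ∀ a ∈ J, star a ∈ J) (T : Set (FreeAlg N))
    (hT : ∀ b ∈ T, star b ∈ T) : IsClosed (commutantMod J hJ T hT : Set (FreeAlg N)) := by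
  have h : (commutantMod J hJ T hT : Set (FreeAlg N)) =
      ⋂ b ∈ T, (fun a => a * b - b * a) ⁻¹' (J : Set (FreeAlg N)) := by
    ext a
    simp only [Set.mem_iInter]
    rfl
  rw [h]
  exact isClosed_biInter fun b _ => hcl.preimage (by fun_prop)

/-- Two commutants in succession: modulo `J`, everything commutes with the coordinates because the
coordinates do, and then the coordinates, hence everything, commute with all elements. -/
theorem commutator_mem {J : TwoSidedIdeal (FreeAlg N)} (hcl : IsClosed (J : Set (FreeAlg N)))
    (hJ : ∀ a ∈ J, star a ∈ J) (h : ∀ i j : Fin N, coord i * coord j - coord j * coord i ∈ J)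
    (a b : FreeAlg N) : a * b - b * a ∈ J := by
  have h1 : ∀ a : FreeAlg N, ∀ i : Fin N, a * coord i - coord i * a ∈ J := fun a i => by
    have hT : ∀ b ∈ Set.range (coord (N := N)), star b ∈ Set.range (coord (N := N)) := by
      rintro _ ⟨j, rfl⟩
      exact ⟨j, (star_coord j).symm⟩
    refine eq_top_of_coord_mem (commutantMod J hJ _ hT) (isClosed_commutantMod hcl hJ _ hT)
      (fun j => ?_) a (coord i) ⟨i, rfl⟩
    rintro _ ⟨k, rfl⟩
    exact h j k
  refine eq_top_of_coord_mem (commutantMod J hJ Set.univ fun _ _ => trivial)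
    (isClosed_commutantMod hcl hJ _ _) (fun j b _ => ?_) a b trivial
  have := J.neg_mem (h1 b j)
  rwa [neg_sub] at this

/-- The adjoint of an ideal. -/
noncomputable def starIdeal (J : TwoSidedIdeal (FreeAlg N)) : TwoSidedIdeal (FreeAlg N) :=
  TwoSidedIdeal.mk' {a | star a ∈ J} (by simp [J.zero_mem])
    (fun {a b} ha hb => by
      rw [Set.mem_ofPred_eq, star_add]
      exact J.add_mem ha hb)
    (fun {a} ha => by
      rw [Set.mem_ofPred_eq, star_neg]
      exact J.neg_mem ha)
    (fun {a b} hb => by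
      rw [Set.mem_ofPred_eq, star_mul]
      exact J.mul_mem_right _ _ hb)
    (fun {a b} ha => by
      rw [Set.mem_ofPred_eq, star_mul]
      exact J.mul_mem_left _ _ ha)

theorem mem_starIdeal (J : TwoSidedIdeal (FreeAlg N)) (a : FreeAlg N) :
    a ∈ starIdeal J ↔ star a ∈ J := TwoSidedIdeal.mem_mk' ..

/-- The adjoint of the generated ideal is a closed ideal containing `R`, so it contains the
generated one. -/
theorem star_mem_ofRelations {R : Set (FreeAlg N)} (hR : ∀ r ∈ R, star r ∈ (ofRelations R).ideal)
    (a : FreeAlg N) (ha : a ∈ (ofRelations R).ideal) : star a ∈ (ofRelations R).ideal := by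
  rw [← mem_starIdeal]
  refine mem_ofRelations.1 ha _ ?_ fun r hr => (mem_starIdeal _ _).2 (hR r hr)
  have h : (starIdeal (ofRelations R).ideal : Set (FreeAlg N)) =
      star ⁻¹' ((ofRelations R).ideal : Set (FreeAlg N)) := by
    ext b
    exact mem_starIdeal _ _
  rw [h]
  exact (ofRelations R).isClosed.preimage continuous_star

theorem toReal_coord (i : Fin N) : toReal N (coord i) = realCoord i := lift_coord _ _ _ i

/-- The characters of `C(S^{N-1}_{ℝ,+})` are the points of the usual sphere. -/
theorem exists_point (ψ : FreeAlg N →⋆ₐ[ℂ] ℂ) :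
    ∃ p : UnitSphere N, ∀ a, ψ a = toReal N a p := by
  have hre : ∀ i, ((ψ (coord i)).re : ℂ) = ψ (coord i) := fun i => by
    have h : star (ψ (coord i)) = ψ (coord i) := by rw [← map_star, star_coord]
    exact Complex.conj_eq_iff_re.1 h
  have hsum : ∑ i, (ψ (coord i)).re ^ 2 = 1 := by
    have h := congrArg ψ (sum_coord_sq N)
    simp only [map_sum, map_mul, map_one] at h
    have h2 : ((∑ i, (ψ (coord i)).re ^ 2 : ℝ) : ℂ) = 1 := by
      rw [← h]
      push_cast
      refine Finset.sum_congr rfl fun i _ => ?_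
      rw [hre, sq]
    exact_mod_cast h2
  refine ⟨⟨WithLp.toLp 2 fun i => (ψ (coord i)).re, ?_⟩, fun a => ?_⟩
  · rw [mem_sphere_zero_iff_norm, EuclideanSpace.norm_eq]
    simp [hsum]
  · set p : UnitSphere N := ⟨WithLp.toLp 2 fun i => (ψ (coord i)).re, _⟩
    have h : ψ = (ContinuousMap.evalStarAlgHom ℂ ℂ p).comp (toReal N) := hom_ext fun i => by
      rw [StarAlgHom.comp_apply, toReal_coord]
      exact (hre i).symm
    rw [h]
    rfl

/-- The relations defining the usual sphere. -/
def commutators (N : ℕ) : Set (FreeAlg N) :=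
  {r | ∃ i j : Fin N, r = coord i * coord j - coord j * coord i}

/-- The algebra `C(S^{N-1}_ℝ)` is the abelianization of `C(S^{N-1}_{ℝ,+})`. -/
theorem realSphere_eq : realSphere N = ofRelations (commutators N) := by
  set J := (ofRelations (commutators N)).ideal with hJdef
  have hstar : ∀ a ∈ J, star a ∈ J := star_mem_ofRelations (by
    rintro _ ⟨i, j, rfl⟩
    refine subset_ofRelations _ ⟨j, i, ?_⟩
    simp [star_coord])
  have hcl : IsClosed (J : Set (FreeAlg N)) := (ofRelations (commutators N)).isClosed
  have hcomm : ∀ a b : FreeAlg N, a * b - b * a ∈ J :=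
    commutator_mem hcl hstar fun i j => subset_ofRelations _ ⟨i, j, rfl⟩
  refine Subspace.ext (le_antisymm (fun a ha => ?_) ?_)
  · have ha0 : toReal N a = 0 := (TwoSidedIdeal.mem_ker _).1 ha
    have hcl' : IsClosed (J.asIdeal : Set (FreeAlg N)) := by
      have h : (J.asIdeal : Set (FreeAlg N)) = J := by
        ext
        exact TwoSidedIdeal.mem_asIdeal
      rwa [h]
    let _ := quotientCommCStarAlgebra J.asIdeal
      (fun a ha => TwoSidedIdeal.mem_asIdeal.2 (hstar a (TwoSidedIdeal.mem_asIdeal.1 ha)))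
      (fun a b => TwoSidedIdeal.mem_asIdeal.2 (hcomm a b))
    -- The Gelfand transform of the commutative quotient is injective, and its characters come from
    -- points of the usual sphere, where `a` vanishes.
    have hzero : (Ideal.Quotient.mk J.asIdeal a : FreeAlg N ⧸ J.asIdeal) = 0 := by
      refine (gelfandTransform_isometry (FreeAlg N ⧸ J.asIdeal)).injective ?_
      rw [map_zero]
      ext φ
      let χ : FreeAlg N →ₐ[ℂ] ℂ :=
        { toFun := fun b => φ (Ideal.Quotient.mk J.asIdeal b)
          map_one' := map_one φ
          map_mul' := fun b c => map_mul φ (Ideal.Quotient.mk J.asIdeal b)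
            (Ideal.Quotient.mk J.asIdeal c)
          map_zero' := map_zero φ
          map_add' := fun b c => map_add φ (Ideal.Quotient.mk J.asIdeal b)
            (Ideal.Quotient.mk J.asIdeal c)
          commutes' := fun z => AlgHomClass.commutes φ z }
      -- A character of a C⋆-algebra automatically preserves the involution.
      obtain ⟨p, hp⟩ := exists_point { χ with map_star' := fun b => map_star χ b }
      have h := hp a
      rw [ha0] at h
      exact h
    exact TwoSidedIdeal.mem_asIdeal.1 (Ideal.Quotient.eq_zero_iff_mem.1 hzero)
  · refine (ofRelations_ideal_le (realSphere N).isClosed).2 ?_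
    rintro _ ⟨i, j, rfl⟩
    refine (TwoSidedIdeal.mem_ker _).2 ?_
    rw [map_sub, map_mul, map_mul, mul_comm, sub_self]

theorem realSphere_ideal_le {I : TwoSidedIdeal (FreeAlg N)}
    (hI : IsClosed (I : Set (FreeAlg N))) :
    (realSphere N).ideal ≤ I ↔ PairwiseCommute (coordMod I) := by
  have h : ∀ i j : Fin N, coord i * coord j - coord j * coord i ∈ I ↔
      coordMod I i * coordMod I j = coordMod I j * coordMod I i := fun i j => by
    rw [mem_iff_mk_eq_zero, map_sub, sub_eq_zero]
    rfl
  rw [realSphere_eq, ofRelations_ideal_le hI]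
  refine ⟨fun hs i j => (h i j).1 (hs ⟨i, j, rfl⟩), ?_⟩
  rintro hs _ ⟨i, j, rfl⟩
  exact (h i j).2 (hs i j)

end RealSphere

/-! ### Vanishing monomials from merged relations. -/

section Vanishing

variable {ι A : Type*} [Ring A] [Algebra ℂ A]

theorem eq_zero_of_eq_neg_self {a : A} (h : a = -a) : a = 0 := by
  have h2 : (2 : ℂ) • a = 0 := by
    rw [two_smul]
    nth_rw 2 [h]
    exact add_neg_cancel a
  exact (smul_eq_zero.1 h2).resolve_left two_ne_zero

variable {N : ℕ} {x : Fin N → A}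

theorem pairwiseCommute_and_twist_iff :
    (PairwiseCommute x ∧ ∀ i j, i ≠ j → x i * x j = 0) ↔
      PairwiseCommute x ∧ PairwiseCommute (twist x) := by
  rw [pairwiseCommute_twist_iff]
  refine and_congr_right fun hx => forall_congr' fun i => forall_congr' fun j =>
    forall_congr' fun hij => ⟨fun h => ?_, fun h => ?_⟩
  · rw [hx j i, h, neg_zero]
  · rw [hx j i] at h
    exact eq_zero_of_eq_neg_self h

theorem halfCommute_and_twist_iff :
    (HalfCommute x ∧ ∀ i j k, (i ≠ j ∧ j ≠ k ∧ i ≠ k) → x i * x j * x k = 0) ↔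
      HalfCommute x ∧ HalfCommute (twist x) := by
  rw [halfCommute_twist_iff]
  refine and_congr_right fun hx => ⟨fun h => ⟨fun i j k hd => ?_, fun i j k _ => hx i j k⟩,
    fun h i j k hd => ?_⟩
  · rw [hx k j i, h i j k hd, neg_zero]
  · have h1 := h.1 i j k hd
    rw [hx k j i] at h1
    exact eq_zero_of_eq_neg_self h1

/-- When the products of three distinct coordinates vanish, the signs of twisted half-commutation
are invisible. -/
theorem halfCommute_of_twist (h : HalfCommute (twist x))
    (h0 : ∀ i j k, (i ≠ j ∧ j ≠ k ∧ i ≠ k) → x i * x j * x k = 0) : HalfCommute x := by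
  rw [halfCommute_twist_iff] at h
  intro i j k
  by_cases hd : i ≠ j ∧ j ≠ k ∧ i ≠ k
  · rw [h0 i j k hd, h0 k j i ⟨hd.2.1.symm, hd.1.symm, hd.2.2.symm⟩]
  · exact h.2 i j k hd

end Vanishing

/-! ### The nine spheres as intersections. -/

section Table

variable {N : ℕ} {I : TwoSidedIdeal (FreeAlg N)}

theorem vanishing_ideal_le (hI : IsClosed (I : Set (FreeAlg N))) (d : ℕ) (S : Subspace N) :
    (vanishing d S).ideal ≤ I ↔ S.ideal ≤ I ∧ ∀ i : Fin (d + 1) → Fin N, Function.Injective i →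
      (List.ofFn fun p => coordMod I (i p)).prod = 0 := by
  rw [vanishing, inter_ideal_le hI, ofRelations_ideal_le hI]
  refine and_congr_right fun _ => ⟨fun h i hi => ?_, ?_⟩
  · rw [← mk_monomial, ← mem_iff_mk_eq_zero]
    exact h ⟨i, hi, rfl⟩
  · rintro h _ ⟨i, hi, rfl⟩
    rw [SetLike.mem_coe, mem_iff_mk_eq_zero, mk_monomial]
    exact h i hi

theorem vanishing_one_ideal_le (hI : IsClosed (I : Set (FreeAlg N))) (S : Subspace N) :
    (vanishing 1 S).ideal ≤ I ↔
      S.ideal ≤ I ∧ ∀ i j, i ≠ j → coordMod I i * coordMod I j = 0 := by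
  rw [vanishing_ideal_le hI]
  refine and_congr_right fun _ => ⟨fun h i j hij => ?_, fun h i hi => ?_⟩
  · have h1 : Function.Injective ![i, j] := by
      intro p q
      fin_cases p <;> fin_cases q <;> simp [hij, hij.symm]
    simpa [List.ofFn_succ] using h _ h1
  · simpa [List.ofFn_succ] using h (i 0) (i 1) (hi.ne (by decide))

theorem vanishing_two_ideal_le (hI : IsClosed (I : Set (FreeAlg N))) (S : Subspace N) :
    (vanishing 2 S).ideal ≤ I ↔ S.ideal ≤ I ∧ ∀ i j k, (i ≠ j ∧ j ≠ k ∧ i ≠ k) →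
      coordMod I i * coordMod I j * coordMod I k = 0 := by
  rw [vanishing_ideal_le hI]
  refine and_congr_right fun _ => ⟨fun h i j k hd => ?_, fun h i hi => ?_⟩
  · have h1 : Function.Injective ![i, j, k] := by
      obtain ⟨hij, hjk, hik⟩ := hd
      intro p q
      fin_cases p <;> fin_cases q <;> simp [hij, hij.symm, hjk, hjk.symm, hik, hik.symm]
    simpa [List.ofFn_succ, mul_assoc] using h _ h1
  · simpa [List.ofFn_succ, mul_assoc] using h (i 0) (i 1) (i 2)
      ⟨hi.ne (by decide), hi.ne (by decide), hi.ne (by decide)⟩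

/-- The table of polygonal spheres is made of intersections. -/
theorem nineMain_eq_inter (b a : Fin 3) :
    nineMain N b a = inter (untwistedMain N a) (twistedMain N b) := by
  refine subspace_eq_of_forall fun I hI => ?_
  rw [inter_ideal_le hI]
  have hfree := freeSphere_ideal_le I hI
  have hreal := realSphere_ideal_le hI
  have hhalf := halfSphere_ideal_le hI
  have htw := twistedSphere_ideal_le hI
  have htwh := twistedHalfSphere_ideal_le hI
  have h3 := halfCommute_and_twist_iff (x := coordMod I)
  have hRH : PairwiseCommute (coordMod I) → HalfCommute (coordMod I) := fun h => h.halfCommute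
  have hRH' : PairwiseCommute (twist (coordMod I)) → HalfCommute (twist (coordMod I)) :=
    fun h => h.halfCommute
  have h4 := halfCommute_of_twist (x := coordMod I)
  fin_cases b <;> fin_cases a
  · change (vanishing 1 (realSphere N)).ideal ≤ I ↔
      (realSphere N).ideal ≤ I ∧ (twistedSphere N).ideal ≤ I
    rw [vanishing_one_ideal_le hI, hreal, htw]
    exact pairwiseCommute_and_twist_iff
  · change (vanishing 2 (twistedSphere N)).ideal ≤ I ↔
      (halfSphere N).ideal ≤ I ∧ (twistedSphere N).ideal ≤ I
    rw [vanishing_two_ideal_le hI, hhalf, htw]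
    -- Anticommutation gives twisted half-commutation, to be compared with half-commutation: the two
    -- differ by the vanishing of triple products.
    exact ⟨fun ⟨h, h0⟩ => ⟨h4 (hRH' h) h0, h⟩, fun ⟨h, h'⟩ => ⟨h', (h3.2 ⟨h, hRH' h'⟩).2⟩⟩
  · exact (and_iff_right hfree).symm
  · change (vanishing 2 (realSphere N)).ideal ≤ I ↔
      (realSphere N).ideal ≤ I ∧ (twistedHalfSphere N).ideal ≤ I
    rw [vanishing_two_ideal_le hI, hreal, htwh]
    exact ⟨fun ⟨h, h0⟩ => ⟨h, (h3.1 ⟨hRH h, h0⟩).2⟩, fun ⟨h, h'⟩ => ⟨h, (h3.2 ⟨hRH h, h'⟩).2⟩⟩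
  · change (vanishing 2 (halfSphere N)).ideal ≤ I ↔
      (halfSphere N).ideal ≤ I ∧ (twistedHalfSphere N).ideal ≤ I
    rw [vanishing_two_ideal_le hI, hhalf, htwh]
    exact h3
  · exact (and_iff_right hfree).symm
  · exact (and_iff_left hfree).symm
  · exact (and_iff_left hfree).symm
  · exact (and_iff_left hfree).symm

end Table

/-! ### Inclusions, and the monomial and polygonal spheres. -/

section Monomial

variable (N : ℕ)

theorem realSphere_le_halfSphere : realSphere N ≤ halfSphere N :=
  (halfSphere_ideal_le (realSphere N).isClosed).2
    ((realSphere_ideal_le (realSphere N).isClosed).1 le_rfl).halfCommute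

theorem le_freeSphere (S : Subspace N) : S ≤ freeSphere N := freeSphere_ideal_le _ S.isClosed

theorem twistedSphere_le_twistedHalfSphere : twistedSphere N ≤ twistedHalfSphere N :=
  (twistedHalfSphere_ideal_le (twistedSphere N).isClosed).2
    ((twistedSphere_ideal_le (twistedSphere N).isClosed).1 le_rfl).halfCommute

variable {N} {E : Set Permutation}

theorem untwistedMonomial_eq_freeSphere (hE : ∀ σ ∈ E, σ.2 = 1) :
    untwistedMonomial N E = freeSphere N := subspace_eq_of_forall fun I hI => by
  rw [untwistedMonomial_ideal_le hI, iff_true_right (freeSphere_ideal_le I hI)]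
  intro σ hσ
  rw [hE σ hσ]
  exact fun _ => rfl

theorem untwistedMonomial_eq_halfSphere (hE : ∀ σ ∈ E, PreservesParity σ.2)
    (hE' : ∃ σ ∈ E, σ.2 ≠ 1) : untwistedMonomial N E = halfSphere N :=
  subspace_eq_of_forall fun I hI => by
    rw [untwistedMonomial_ideal_le hI, halfSphere_ideal_le hI,
      forall_finRel_iff_halfCommute (sum_coordMod_sq I) hE hE']

theorem untwistedMonomial_eq_realSphere (hE : ∃ σ ∈ E, ¬ PreservesParity σ.2) :
    untwistedMonomial N E = realSphere N :=
  subspace_eq_of_forall fun I hI => by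
    rw [untwistedMonomial_ideal_le hI, realSphere_ideal_le hI,
      forall_finRel_iff_pairwiseCommute (sum_coordMod_sq I) hE]

theorem twistedMonomial_eq_freeSphere (hE : ∀ σ ∈ E, σ.2 = 1) :
    twistedMonomial N E = freeSphere N := subspace_eq_of_forall fun I hI => by
  rw [twistedMonomial_ideal_le hI, iff_true_right (freeSphere_ideal_le I hI)]
  intro σ hσ
  rw [hE σ hσ]
  exact fun _ => rfl

theorem twistedMonomial_eq_twistedHalfSphere (hE : ∀ σ ∈ E, PreservesParity σ.2)
    (hE' : ∃ σ ∈ E, σ.2 ≠ 1) : twistedMonomial N E = twistedHalfSphere N :=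
  subspace_eq_of_forall fun I hI => by
    rw [twistedMonomial_ideal_le hI, twistedHalfSphere_ideal_le hI,
      forall_finRel_iff_halfCommute (sum_twist_sq (sum_coordMod_sq I)) hE hE']

theorem twistedMonomial_eq_twistedSphere (hE : ∃ σ ∈ E, ¬ PreservesParity σ.2) :
    twistedMonomial N E = twistedSphere N :=
  subspace_eq_of_forall fun I hI => by
    rw [twistedMonomial_ideal_le hI, twistedSphere_ideal_le hI,
      forall_finRel_iff_pairwiseCommute (sum_twist_sq (sum_coordMod_sq I)) hE]

theorem permutations_trichotomy (E : Set Permutation) :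
    (∃ σ ∈ E, ¬ PreservesParity σ.2) ∨
      ((∀ σ ∈ E, PreservesParity σ.2) ∧ ∃ σ ∈ E, σ.2 ≠ 1) ∨ ∀ σ ∈ E, σ.2 = 1 := by
  by_cases h1 : ∃ σ ∈ E, ¬ PreservesParity σ.2
  · exact Or.inl h1
  by_cases h2 : ∃ σ ∈ E, σ.2 ≠ 1
  · push Not at h1
    exact Or.inr (Or.inl ⟨h1, h2⟩)
  · push Not at h2
    exact Or.inr (Or.inr h2)

theorem exists_not_preservesParity :
    ∃ σ ∈ ({⟨2, swap 0 1⟩} : Set Permutation), ¬ PreservesParity σ.2 :=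
  ⟨_, rfl, by unfold PreservesParity; decide⟩

theorem preservesParity_swap : (∀ σ ∈ ({⟨3, swap 0 2⟩} : Set Permutation), PreservesParity σ.2) ∧
    ∃ σ ∈ ({⟨3, swap 0 2⟩} : Set Permutation), σ.2 ≠ 1 := by
  refine ⟨?_, _, rfl, by decide⟩
  rintro _ rfl
  unfold PreservesParity
  decide

variable (N)

theorem range_untwistedMonomial :
    Set.range (untwistedMonomial N) = {realSphere N, halfSphere N, freeSphere N} := by
  refine Set.Subset.antisymm ?_ ?_
  · rintro _ ⟨E, rfl⟩
    rcases permutations_trichotomy E with h | ⟨h, h'⟩ | h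
    · exact Or.inl (untwistedMonomial_eq_realSphere h)
    · exact Or.inr (Or.inl (untwistedMonomial_eq_halfSphere h h'))
    · exact Or.inr (Or.inr (untwistedMonomial_eq_freeSphere h))
  · rintro _ (rfl | rfl | rfl)
    · exact ⟨_, untwistedMonomial_eq_realSphere exists_not_preservesParity⟩
    · exact ⟨_, untwistedMonomial_eq_halfSphere preservesParity_swap.1 preservesParity_swap.2⟩
    · exact ⟨∅, untwistedMonomial_eq_freeSphere fun _ h => h.elim⟩

theorem range_twistedMonomial :
    Set.range (twistedMonomial N) = {twistedSphere N, twistedHalfSphere N, freeSphere N} := by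
  refine Set.Subset.antisymm ?_ ?_
  · rintro _ ⟨E, rfl⟩
    rcases permutations_trichotomy E with h | ⟨h, h'⟩ | h
    · exact Or.inl (twistedMonomial_eq_twistedSphere h)
    · exact Or.inr (Or.inl (twistedMonomial_eq_twistedHalfSphere h h'))
    · exact Or.inr (Or.inr (twistedMonomial_eq_freeSphere h))
  · rintro _ (rfl | rfl | rfl)
    · exact ⟨_, twistedMonomial_eq_twistedSphere exists_not_preservesParity⟩
    · exact ⟨_, twistedMonomial_eq_twistedHalfSphere preservesParity_swap.1 preservesParity_swap.2⟩
    · exact ⟨∅, twistedMonomial_eq_freeSphere fun _ h => h.elim⟩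

theorem range_untwistedMain : Set.range (untwistedMain N) = Set.range (untwistedMonomial N) := by
  rw [range_untwistedMonomial, untwistedMain]
  ext S
  simp [Matrix.range_cons, or_comm, or_assoc]

theorem range_twistedMain : Set.range (twistedMain N) = Set.range (twistedMonomial N) := by
  rw [range_twistedMonomial, twistedMain]
  ext S
  simp [Matrix.range_cons, or_comm, or_assoc]

theorem polygonal_spheres :
    {S | ∃ E F : Set Permutation, S = polygonal N E F} =
      {S | ∃ b a : Fin 3, S = nineMain N b a} := by
  ext S
  simp only [Set.mem_ofPred_eq, nineMain_eq_inter]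
  constructor
  · rintro ⟨E, F, rfl⟩
    obtain ⟨a, ha⟩ := (range_untwistedMain N).ge ⟨E, rfl⟩
    obtain ⟨b, hb⟩ := (range_twistedMain N).ge ⟨F, rfl⟩
    exact ⟨b, a, by rw [ha, hb, polygonal]⟩
  · rintro ⟨b, a, rfl⟩
    obtain ⟨E, hE⟩ := (range_untwistedMain N).le ⟨a, rfl⟩
    obtain ⟨F, hF⟩ := (range_twistedMain N).le ⟨b, rfl⟩
    exact ⟨E, F, by rw [polygonal, hE, hF]⟩

end Monomial

/-! ### Explicit solutions of the relations. -/

section Witnesses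

variable {N : ℕ}

/-- The ideal of the elements vanishing at a given solution of the relations. -/
noncomputable def tupleIdeal (t : SphereTuple N) : TwoSidedIdeal (FreeAlg N) :=
  (ofHom (evalHom t)).ideal

theorem isClosed_tupleIdeal (t : SphereTuple N) : IsClosed (tupleIdeal t : Set (FreeAlg N)) :=
  (ofHom (evalHom t)).isClosed

/-- Relations modulo the ideal of a solution can thus be checked in its C⋆-algebra. -/
theorem mk_eq_mk_iff (t : SphereTuple N) (r s : FreeAlg N) :
    (tupleIdeal t).ringCon.mk' r = (tupleIdeal t).ringCon.mk' s ↔ evalHom t r = evalHom t s := by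
  rw [← sub_eq_zero, ← map_sub, ← mem_iff_mk_eq_zero, ← sub_eq_zero (b := evalHom t s), ← map_sub]
  exact TwoSidedIdeal.mem_ker _

theorem coordMod_two (t : SphereTuple N) (i j : Fin N) :
    coordMod (tupleIdeal t) i * coordMod (tupleIdeal t) j =
      (tupleIdeal t).ringCon.mk' (coord i * coord j) := rfl

theorem coordMod_three (t : SphereTuple N) (i j k : Fin N) :
    coordMod (tupleIdeal t) i * coordMod (tupleIdeal t) j * coordMod (tupleIdeal t) k =
      (tupleIdeal t).ringCon.mk' (coord i * coord j * coord k) := rfl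

theorem realSphere_le_tupleIdeal (t : SphereTuple N) :
    (realSphere N).ideal ≤ tupleIdeal t ↔ PairwiseCommute t.x := by
  simp only [realSphere_ideal_le (isClosed_tupleIdeal t), PairwiseCommute, coordMod_two,
    mk_eq_mk_iff]
  simp only [map_mul, evalHom_coord]

theorem halfSphere_le_tupleIdeal (t : SphereTuple N) :
    (halfSphere N).ideal ≤ tupleIdeal t ↔ HalfCommute t.x := by
  simp only [halfSphere_ideal_le (isClosed_tupleIdeal t), HalfCommute, coordMod_three,
    mk_eq_mk_iff]
  simp only [map_mul, evalHom_coord]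

theorem twistedSphere_le_tupleIdeal (t : SphereTuple N) :
    (twistedSphere N).ideal ≤ tupleIdeal t ↔ PairwiseCommute (twist t.x) := by
  simp only [twistedSphere_ideal_le (isClosed_tupleIdeal t), pairwiseCommute_twist_iff,
    coordMod_two, ← map_neg, mk_eq_mk_iff]
  simp only [map_neg, map_mul, evalHom_coord]

theorem twistedHalfSphere_le_tupleIdeal (t : SphereTuple N) :
    (twistedHalfSphere N).ideal ≤ tupleIdeal t ↔ HalfCommute (twist t.x) := by
  simp only [twistedHalfSphere_ideal_le (isClosed_tupleIdeal t), halfCommute_twist_iff,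
    coordMod_three, ← map_neg, mk_eq_mk_iff]
  simp only [map_neg, map_mul, evalHom_coord]

/-- The scalar `1 / √n`. -/
noncomputable def invSqrt (n : ℕ) : ℂ := (((Real.sqrt n)⁻¹ : ℝ) : ℂ)

theorem star_invSqrt (n : ℕ) : star (invSqrt n) = invSqrt n := Complex.conj_ofReal _

theorem invSqrt_mul_self {n : ℕ} (hn : 0 < n) : (n : ℂ) * (invSqrt n * invSqrt n) = 1 := by
  have h : (n : ℝ) * ((Real.sqrt n)⁻¹ * (Real.sqrt n)⁻¹) = 1 := by
    rw [← mul_inv, Real.mul_self_sqrt (Nat.cast_nonneg n), mul_inv_cancel₀ (by positivity)]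
  rw [invSqrt]
  exact_mod_cast h

theorem invSqrt_ne_zero {n : ℕ} (hn : 0 < n) : invSqrt n ≠ 0 := fun h => by
  have := invSqrt_mul_self hn
  simp [h] at this

/-- The solution of the relations given by `n` symmetries, multiplied by `1 / √n`. -/
noncomputable def tupleOfSymmetries {B : Type} [CStarAlgebra B] [Nontrivial B] (v : ℕ → B)
    (hs : ∀ i, star (v i) = v i) (hv : ∀ i, v i * v i = 1) (n : ℕ) (hn : 0 < n) (hnN : n ≤ N) :
    SphereTuple N where
  A := B
  x i := if (i : ℕ) < n then invSqrt n • v i else 0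
  star_x i := by
    split_ifs
    · rw [star_smul, star_invSqrt, hs]
    · exact star_zero B
  sum_sq := by
    have h : ∀ i : ℕ, (if i < n then invSqrt n • v i else 0) *
        (if i < n then invSqrt n • v i else 0) =
        if i < n then (invSqrt n * invSqrt n) • (1 : B) else 0 := fun i => by
      split_ifs
      · rw [smul_mul_smul_comm, hv]
      · exact mul_zero 0
    simp only [h]
    rw [Finset.sum_fin_eq_sum_range, ← Finset.sum_range_add_sum_Ico _ hnN]
    have h1 : ∀ i ∈ Finset.range n, (if h : i < N then
        (if i < n then (invSqrt n * invSqrt n) • (1 : B) else 0) else 0) =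
        (invSqrt n * invSqrt n) • (1 : B) := fun i hi => by
      have := Finset.mem_range.1 hi
      rw [dif_pos (by omega), if_pos this]
    have h2 : ∀ i ∈ Finset.Ico n N, (if h : i < N then
        (if i < n then (invSqrt n * invSqrt n) • (1 : B) else 0) else 0) = 0 := fun i hi => by
      have := Finset.mem_Ico.1 hi
      rw [dif_pos this.2, if_neg (by omega)]
    rw [Finset.sum_congr rfl h1, Finset.sum_eq_zero h2, add_zero, Finset.sum_const,
      Finset.card_range, ← Nat.cast_smul_eq_nsmul ℂ, smul_smul, invSqrt_mul_self hn, one_smul]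

section Symmetries

variable {B : Type} [CStarAlgebra B] [Nontrivial B] {v : ℕ → B} {hs : ∀ i, star (v i) = v i}
  {hv : ∀ i, v i * v i = 1} {n : ℕ} {hn : 0 < n} {hnN : n ≤ N}

theorem tupleOfSymmetries_x (i : Fin N) : (tupleOfSymmetries v hs hv n hn hnN).x i =
    if (i : ℕ) < n then invSqrt n • v i else 0 := rfl

theorem tupleOfSymmetries_mul_eq_zero (hn2 : n = 2) (i j k : Fin N)
    (hd : i ≠ j ∧ j ≠ k ∧ i ≠ k) :
    (tupleOfSymmetries v hs hv n hn hnN).x i * (tupleOfSymmetries v hs hv n hn hnN).x j *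
      (tupleOfSymmetries v hs hv n hn hnN).x k = 0 := by
  obtain ⟨h1, h2, h3⟩ := hd
  rw [Ne, Fin.ext_iff] at h1 h2 h3
  by_cases hi : (i : ℕ) < n
  · by_cases hj : (j : ℕ) < n
    · have hk : ¬ (k : ℕ) < n := by omega
      rw [tupleOfSymmetries_x k, if_neg hk]
      exact mul_zero _
    · rw [tupleOfSymmetries_x j, if_neg hj]
      exact (congrArg (· * _) (mul_zero _)).trans (zero_mul _)
  · rw [tupleOfSymmetries_x i, if_neg hi]
    exact (congrArg (· * _) (zero_mul _)).trans (zero_mul _)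

theorem pairwiseCommute_tupleOfSymmetries (h : ∀ i j, i < n → j < n → v i * v j = v j * v i) :
    PairwiseCommute (tupleOfSymmetries v hs hv n hn hnN).x := fun i j => by
  change (if (i : ℕ) < n then invSqrt n • v i else 0) * (if (j : ℕ) < n then invSqrt n • v j else 0)
    = (if (j : ℕ) < n then invSqrt n • v j else 0) * (if (i : ℕ) < n then invSqrt n • v i else 0)
  split_ifs with hi hj
  · rw [smul_mul_smul_comm, smul_mul_smul_comm, h i j hi hj]
  all_goals simp

theorem pairwiseCommute_twist_tupleOfSymmetries
    (h : ∀ i j, i < n → j < n → i ≠ j → v i * v j = -(v j * v i)) :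
    PairwiseCommute (twist (tupleOfSymmetries v hs hv n hn hnN).x) := by
  rw [pairwiseCommute_twist_iff]
  intro i j hij
  change (if (i : ℕ) < n then invSqrt n • v i else 0) * (if (j : ℕ) < n then invSqrt n • v j else 0)
    = -((if (j : ℕ) < n then invSqrt n • v j else 0) *
      (if (i : ℕ) < n then invSqrt n • v i else 0))
  split_ifs with hi hj
  · rw [smul_mul_smul_comm, smul_mul_smul_comm, h i j hi hj (Fin.val_injective.ne hij), smul_neg]
  all_goals simp

end Symmetries

section Pauli

open scoped Matrix.Norms.L2Operator

/-- The Pauli matrices. -/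
noncomputable def pauli : ℕ → Matrix (Fin 2) (Fin 2) ℂ
  | 0 => !![0, 1; 1, 0]
  | 1 => !![0, -Complex.I; Complex.I, 0]
  | _ => !![1, 0; 0, -1]

theorem star_pauli (i : ℕ) : star (pauli i) = pauli i := by
  rcases i with _ | _ | i <;> ext p q <;> fin_cases p <;> fin_cases q <;>
    simp [pauli, Matrix.star_apply]

theorem pauli_mul_self (i : ℕ) : pauli i * pauli i = 1 := by
  rcases i with _ | _ | i <;> simp [pauli, Matrix.one_fin_two]

theorem pauli_anticommute {i j : ℕ} (hi : i < 3) (hj : j < 3) (hij : i ≠ j) :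
    pauli i * pauli j = -(pauli j * pauli i) := by
  interval_cases i <;> interval_cases j <;> first | exact absurd rfl hij | simp [pauli]

theorem pauli_two_ne : pauli 0 * pauli 1 ≠ pauli 1 * pauli 0 := fun h => by
  have h0 := congrFun (congrFun h 0) 0
  simp only [pauli, Matrix.mul_apply, Fin.sum_univ_two, Matrix.of_apply, Matrix.cons_val_zero,
    Matrix.cons_val_one, Matrix.cons_val', Matrix.cons_val_fin_one] at h0
  have := congrArg Complex.im h0
  norm_num at this

theorem pauli_three_ne : pauli 0 * pauli 1 * pauli 2 ≠ pauli 2 * pauli 1 * pauli 0 := fun h => by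
  have h0 := congrFun (congrFun h 0) 0
  simp only [pauli, Matrix.mul_apply, Fin.sum_univ_two, Matrix.of_apply, Matrix.cons_val_zero,
    Matrix.cons_val_one, Matrix.cons_val', Matrix.cons_val_fin_one] at h0
  have := congrArg Complex.im h0
  norm_num at this

/-- The solution of the relations given by the first `n` Pauli matrices. -/
noncomputable def pauliTuple (n : ℕ) (hn : 0 < n) (hnN : n ≤ N) : SphereTuple N :=
  tupleOfSymmetries pauli star_pauli pauli_mul_self n hn hnN

/-- The point `(1, …, 1, 0, …, 0) / √n` of the sphere. -/
noncomputable def scalarTuple (n : ℕ) (hn : 0 < n) (hnN : n ≤ N) : SphereTuple N :=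
  tupleOfSymmetries (fun _ => (1 : ℂ)) (fun _ => star_one ℂ) (fun _ => mul_one 1) n hn hnN

theorem smul_mul_smul_mul_smul {B : Type*} [Ring B] [Algebra ℂ B] (z : ℂ) (a b c : B) :
    (z • a) * (z • b) * (z • c) = (z * z * z) • (a * b * c) := by
  rw [smul_mul_smul_comm, smul_mul_smul_comm]

theorem pauliTuple_pairwiseCommute_twist {n : ℕ} (hn : 0 < n) (hnN : n ≤ N) (hn3 : n ≤ 3) :
    PairwiseCommute (twist (pauliTuple n hn hnN).x) :=
  pairwiseCommute_twist_tupleOfSymmetries fun _ _ hi hj hij =>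
    pauli_anticommute (by omega) (by omega) hij

/-- Only two coordinates are nonzero, so triple products of distinct coordinates vanish and
anticommutation yields half-commutation. -/
theorem pauliTuple_two_halfCommute (hN : 2 ≤ N) :
    HalfCommute (pauliTuple 2 two_pos hN).x :=
  halfCommute_of_twist (pauliTuple_pairwiseCommute_twist two_pos hN (by norm_num)).halfCommute
    (tupleOfSymmetries_mul_eq_zero rfl)

theorem pauliTuple_two_not_pairwiseCommute (hN : 2 ≤ N) :
    ¬ PairwiseCommute (pauliTuple 2 two_pos hN).x := fun h => by
  have h1 : (invSqrt 2 • pauli 0) * (invSqrt 2 • pauli 1) =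
      (invSqrt 2 • pauli 1) * (invSqrt 2 • pauli 0) := h ⟨0, by omega⟩ ⟨1, by omega⟩
  rw [smul_mul_smul_comm, smul_mul_smul_comm] at h1
  have hz : invSqrt 2 ≠ 0 := invSqrt_ne_zero two_pos
  exact pauli_two_ne (smul_right_injective _ (mul_ne_zero hz hz) h1)

/-- The product of the three Pauli matrices is a nonzero scalar, and reversing it changes the sign.
-/
theorem pauliTuple_three_not_halfCommute (hN : 3 ≤ N) :
    ¬ HalfCommute (pauliTuple 3 three_pos hN).x := fun h => by
  have h1 : (invSqrt 3 • pauli 0) * (invSqrt 3 • pauli 1) * (invSqrt 3 • pauli 2) =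
      (invSqrt 3 • pauli 2) * (invSqrt 3 • pauli 1) * (invSqrt 3 • pauli 0) :=
    h ⟨0, by omega⟩ ⟨1, by omega⟩ ⟨2, by omega⟩
  rw [smul_mul_smul_mul_smul, smul_mul_smul_mul_smul] at h1
  have hz : invSqrt 3 ≠ 0 := invSqrt_ne_zero three_pos
  exact pauli_three_ne (smul_right_injective _ (mul_ne_zero (mul_ne_zero hz hz) hz) h1)

theorem scalarTuple_pairwiseCommute {n : ℕ} (hn : 0 < n) (hnN : n ≤ N) :
    PairwiseCommute (scalarTuple n hn hnN).x :=
  pairwiseCommute_tupleOfSymmetries fun _ _ _ _ => rfl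

theorem scalarTuple_two_halfCommute_twist (hN : 2 ≤ N) :
    HalfCommute (twist (scalarTuple 2 two_pos hN).x) :=
  (halfCommute_and_twist_iff.1 ⟨(scalarTuple_pairwiseCommute two_pos hN).halfCommute,
    tupleOfSymmetries_mul_eq_zero rfl⟩).2

theorem scalarTuple_two_not_pairwiseCommute_twist (hN : 2 ≤ N) :
    ¬ PairwiseCommute (twist (scalarTuple 2 two_pos hN).x) := fun h => by
  rw [pairwiseCommute_twist_iff] at h
  have h1 : (invSqrt 2 • (1 : ℂ)) * (invSqrt 2 • (1 : ℂ)) =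
      -((invSqrt 2 • (1 : ℂ)) * (invSqrt 2 • (1 : ℂ))) :=
    h ⟨0, by omega⟩ ⟨1, by omega⟩ (by simp)
  have hz : invSqrt 2 ≠ 0 := invSqrt_ne_zero two_pos
  simpa [hz] using eq_zero_of_eq_neg_self h1

theorem scalarTuple_three_not_halfCommute_twist (hN : 3 ≤ N) :
    ¬ HalfCommute (twist (scalarTuple 3 three_pos hN).x) := fun h => by
  rw [halfCommute_twist_iff] at h
  have h1 : (invSqrt 3 • (1 : ℂ)) * (invSqrt 3 • (1 : ℂ)) * (invSqrt 3 • (1 : ℂ)) =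
      -((invSqrt 3 • (1 : ℂ)) * (invSqrt 3 • (1 : ℂ)) * (invSqrt 3 • (1 : ℂ))) :=
    h.1 ⟨0, by omega⟩ ⟨1, by omega⟩ ⟨2, by omega⟩ (by simp)
  have hz : invSqrt 3 ≠ 0 := invSqrt_ne_zero three_pos
  simpa [hz] using eq_zero_of_eq_neg_self h1

end Pauli

end Witnesses

/-! ### Separation of the nine spheres. -/

section Distinct

variable {N : ℕ}

theorem untwistedMain_le (a : Fin 3) {I : TwoSidedIdeal (FreeAlg N)}
    (hI : IsClosed (I : Set (FreeAlg N))) (h : PairwiseCommute (coordMod I)) :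
    (untwistedMain N a).ideal ≤ I := by
  fin_cases a
  · exact (realSphere_ideal_le hI).2 h
  · exact (halfSphere_ideal_le hI).2 h.halfCommute
  · exact freeSphere_ideal_le I hI

theorem twistedMain_le (b : Fin 3) {I : TwoSidedIdeal (FreeAlg N)}
    (hI : IsClosed (I : Set (FreeAlg N))) (h : PairwiseCommute (twist (coordMod I))) :
    (twistedMain N b).ideal ≤ I := by
  fin_cases b
  · exact (twistedSphere_ideal_le hI).2 h
  · exact (twistedHalfSphere_ideal_le hI).2 h.halfCommute
  · exact freeSphere_ideal_le I hI

/-- Up to three Pauli matrices anticommute, so they satisfy every twisted relation whatever the row.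
Two of them detect commutation, three detect half-commutation. -/
theorem exists_separating_untwisted (hN : 3 ≤ N) {a a' : Fin 3} (h : a < a') :
    ∃ I : TwoSidedIdeal (FreeAlg N), IsClosed (I : Set (FreeAlg N)) ∧
      (untwistedMain N a').ideal ≤ I ∧ (∀ b, (twistedMain N b).ideal ≤ I) ∧
      ¬ (untwistedMain N a).ideal ≤ I := by
  have htw : ∀ n (hn : 0 < n) (hnN : n ≤ N) (_ : n ≤ 3) b,
      (twistedMain N b).ideal ≤ tupleIdeal (pauliTuple n hn hnN) := fun n hn hnN hn3 b =>
    twistedMain_le b (isClosed_tupleIdeal _) ((twistedSphere_ideal_le (isClosed_tupleIdeal _)).1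
      ((twistedSphere_le_tupleIdeal _).2 (pauliTuple_pairwiseCommute_twist hn hnN hn3)))
  have hN2 : 2 ≤ N := by omega
  have hreal : ¬ (realSphere N).ideal ≤ tupleIdeal (pauliTuple 2 two_pos hN2) := fun h =>
    pauliTuple_two_not_pairwiseCommute hN2 ((realSphere_le_tupleIdeal _).1 h)
  have hhalf : (halfSphere N).ideal ≤ tupleIdeal (pauliTuple 2 two_pos hN2) :=
    (halfSphere_le_tupleIdeal _).2 (pauliTuple_two_halfCommute hN2)
  have hhalf' : ¬ (halfSphere N).ideal ≤ tupleIdeal (pauliTuple 3 three_pos hN) := fun h =>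
    pauliTuple_three_not_halfCommute hN ((halfSphere_le_tupleIdeal _).1 h)
  have hfree := fun t : SphereTuple N => freeSphere_ideal_le _ (isClosed_tupleIdeal t)
  fin_cases a <;> fin_cases a' <;> first | exact absurd h (by decide) | skip
  · exact ⟨_, isClosed_tupleIdeal _, hhalf, htw 2 _ _ (by norm_num), hreal⟩
  · exact ⟨_, isClosed_tupleIdeal _, hfree _, htw 2 _ _ (by norm_num), hreal⟩
  · exact ⟨_, isClosed_tupleIdeal _, hfree _, htw 3 _ _ le_rfl, hhalf'⟩

/-- Scalars satisfy every untwisted relation. The point with two equal nonzero coordinates violates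
anticommutation but not twisted half-commutation; with three, it violates the latter. -/
theorem exists_separating_twisted (hN : 3 ≤ N) {b b' : Fin 3} (h : b < b') :
    ∃ I : TwoSidedIdeal (FreeAlg N), IsClosed (I : Set (FreeAlg N)) ∧
      (twistedMain N b').ideal ≤ I ∧ (∀ a, (untwistedMain N a).ideal ≤ I) ∧
      ¬ (twistedMain N b).ideal ≤ I := by
  have hun : ∀ n (hn : 0 < n) (hnN : n ≤ N) a,
      (untwistedMain N a).ideal ≤ tupleIdeal (scalarTuple n hn hnN) := fun n hn hnN a =>
    untwistedMain_le a (isClosed_tupleIdeal _) ((realSphere_ideal_le (isClosed_tupleIdeal _)).1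
      ((realSphere_le_tupleIdeal _).2 (scalarTuple_pairwiseCommute hn hnN)))
  have hN2 : 2 ≤ N := by omega
  have htw : ¬ (twistedSphere N).ideal ≤ tupleIdeal (scalarTuple 2 two_pos hN2) := fun h =>
    scalarTuple_two_not_pairwiseCommute_twist hN2 ((twistedSphere_le_tupleIdeal _).1 h)
  have hhalf : (twistedHalfSphere N).ideal ≤ tupleIdeal (scalarTuple 2 two_pos hN2) :=
    (twistedHalfSphere_le_tupleIdeal _).2 (scalarTuple_two_halfCommute_twist hN2)
  have hhalf' : ¬ (twistedHalfSphere N).ideal ≤ tupleIdeal (scalarTuple 3 three_pos hN) := fun h =>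
    scalarTuple_three_not_halfCommute_twist hN ((twistedHalfSphere_le_tupleIdeal _).1 h)
  have hfree := fun t : SphereTuple N => freeSphere_ideal_le _ (isClosed_tupleIdeal t)
  fin_cases b <;> fin_cases b' <;> first | exact absurd h (by decide) | skip
  · exact ⟨_, isClosed_tupleIdeal _, hhalf, hun 2 _ _, htw⟩
  · exact ⟨_, isClosed_tupleIdeal _, hfree _, hun 2 _ _, htw⟩
  · exact ⟨_, isClosed_tupleIdeal _, hfree _, hun 3 _ _, hhalf'⟩

theorem nineMain_injective (hN : 3 ≤ N) {b a b' a' : Fin 3}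
    (h : nineMain N b a = nineMain N b' a') : b = b' ∧ a = a' := by
  -- If the second entry had a larger row or column index, a separating solution would lie on it but
  -- not on the first. Exchanging the entries gives equality.
  have hle : ∀ {b a b' a' : Fin 3}, nineMain N b a = nineMain N b' a' → b' ≤ b ∧ a' ≤ a := by
    intro b a b' a' h
    rw [nineMain_eq_inter, nineMain_eq_inter] at h
    constructor <;> by_contra hlt
    · obtain ⟨I, hI, h1, h2, h3⟩ := exists_separating_twisted hN (not_le.1 hlt)
      have h4 := (inter_ideal_le hI).2 ⟨h2 a', h1⟩
      rw [← h] at h4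
      exact h3 ((inter_ideal_le hI).1 h4).2
    · obtain ⟨I, hI, h1, h2, h3⟩ := exists_separating_untwisted hN (not_le.1 hlt)
      have h4 := (inter_ideal_le hI).2 ⟨h1, h2 b'⟩
      rw [← h] at h4
      exact h3 ((inter_ideal_le hI).1 h4).1
  exact ⟨le_antisymm (hle h.symm).1 (hle h).1, le_antisymm (hle h.symm).2 (hle h).2⟩

end Distinct
end QSphere

theorem theorem8p6 (N : ℕ) :
    -- the untwisted monomial spheres
    (QSphere.realSphere N ≤ QSphere.halfSphere N ∧
      QSphere.halfSphere N ≤ QSphere.freeSphere N ∧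
      Set.range (QSphere.untwistedMonomial N) =
        {QSphere.realSphere N, QSphere.halfSphere N, QSphere.freeSphere N}) ∧
    -- the twisted monomial spheres
    (QSphere.twistedSphere N ≤ QSphere.twistedHalfSphere N ∧
      QSphere.twistedHalfSphere N ≤ QSphere.freeSphere N ∧
      Set.range (QSphere.twistedMonomial N) =
        {QSphere.twistedSphere N, QSphere.twistedHalfSphere N, QSphere.freeSphere N}) ∧
    -- the polygonal spheres
    ({S | ∃ E F : Set QSphere.Permutation, S = QSphere.polygonal N E F} =
        {S | ∃ b a : Fin 3, S = QSphere.nineMain N b a} ∧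
      (∀ b a : Fin 3, QSphere.nineMain N b a =
        QSphere.inter (QSphere.untwistedMain N a) (QSphere.twistedMain N b)) ∧
      (3 ≤ N → ∀ b a b' a' : Fin 3,
        QSphere.nineMain N b a = QSphere.nineMain N b' a' → b = b' ∧ a = a')) :=
  ⟨⟨QSphere.realSphere_le_halfSphere N, QSphere.le_freeSphere N _,
      QSphere.range_untwistedMonomial N⟩,
    ⟨QSphere.twistedSphere_le_twistedHalfSphere N, QSphere.le_freeSphere N _,
      QSphere.range_twistedMonomial N⟩,
    QSphere.polygonal_spheres N, QSphere.nineMain_eq_inter,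
    fun hN _ _ _ _ => QSphere.nineMain_injective hN⟩
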